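/- **Setting.** Consider a plant $\dot x_p=f_p(x_p,\hat u,w)$ with $x_p(t)\in\mathbb R^{n_{x_p}}$, disturbance $w(t)\in\mathbb R^{n_w}$, and a controller $\dot x_c=f_c(x_c,\hat x_p)$, $u=g_c(x_c,x_p)$, with $x_c(t)\in\mathbb R^{n_{x_c}}$, $u(t)\in\mathbb R^{n_u}$, where $\hat u,\hat x_p$ are the values of $u, x_p$ at the last sampling instant. Put $x=(x_p,x_c)\in\mathbb R^{n_x}$, $n_x=n_{x_p}+n_{x_c}$, let $e=(e_{x_p},e_{x_c})=(\hat x_p-x_p,\hat x_c-x_c)\in\mathbb R^{n_x}$ be the sampling-induced error, where $\hat x_c$ is the value of $x_c$ at the last sampling instant, and let $$f(x,e,w)=\begin{pmatrix} f_p\big(x_p,\,g_c(x_c+e_{x_c},x_p+e_{x_p}),\,w\big)\\ f_c(x_c,x_p+e_{x_p})\end{pmatrix},\qquad g=-f,$$ where $f$ is assumed to be continuous. For given $S:\mathbb R^{n_\eta}\times\mathbb R^{n_x}\to\mathbb R^{n_\eta}$ and $\Gamma:\mathbb R^{n_x}\times\mathbb R^{n_\eta}\to\mathbb R$, the closed loop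 $\mathcal H_{STC}$ is the hybrid system with state $\xi=(x,e,\eta,\tau,\tau_{\max})\in\mathbb R^{n_x+n_x+n_\eta+2}$, which flows according to $$\dot\xi=(f(x,e,w),\,g(x,e,w),\,0,\,1,\,0)\quad\text{while }\tau\le\tau_{\max},$$ and jumps according to $$\xi^+=(x,\,0,\,S(\eta,x),\,0,\,\Gamma(x,\eta))\quad\text{when }\tau=\tau_{\max}.$$ Solutions are hybrid trajectories: functions $\xi(t,j)$ on a hybrid time domain in $\mathbb R_{\ge0}\times\mathbb N_0$ that are (locally) absolutely continuous in $t$ for each $j$, satisfy the flow condition for almost all $t$ and the jump condition at every jump, for a locally integrable input $w:\mathbb R_{\ge0}\to\mathbb R^{n_w}$. Initial conditions are $x(0,0),e(0,0),\eta(0,0)$ arbitrary and $\tau_{\max}(0,0)=\tau(0,0)\ge0$, so that a sampling takes place at time $0$. The sampling instant $t_j$, $j\in\mathbb N_0$, is the time at which the solution jumps from $(t_j,j)$ to $(t_j,j+1)$. The functions of class $\mathcal K$ are the continuous, strictly increasing functions $\mathbb R_{\ge0}\to\mathbb R_{\ge0}$ that vanish at $0$; those of class $\mathcal K_\infty$ are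 in addition unbounded. A continuous $\beta:\mathbb R_{\ge0}^2\to\mathbb R_{\ge0}$ is of class $\mathcal{KL}$ if $\beta(\cdot,t)\in\mathcal K$ for every $t$, and $\beta(q,\cdot)$ is nonincreasing with limit $0$ at infinity for every $q$; and $\beta:\mathbb R_{\ge0}^3\to\mathbb R_{\ge0}$ is of class $\mathcal{KLL}$ if $\beta(\cdot,r,\cdot),\beta(\cdot,\cdot,r)\in\mathcal{KL}$ for every $r$. The system $\mathcal H_{STC}$ is *input-to-state stable* (ISS) if there are $\beta\in\mathcal{KLL}$ and $\psi\in\mathcal K_\infty$ such that, for all such inputs, initial conditions and solutions and all $(t,j)$ in the domain of the solution, $$|(x,e,\eta)(t,j)|\le\beta\big(|(x,e,\eta)(0,0)|,t,j\big)+\psi(\|w\|_\infty),$$ where $|\cdot|$ is the Euclidean norm and $\|w\|_\infty$ is the essential supremum of $|w|$ (the bound being void if $\|w\|_\infty=\infty$). **Assumption A** for $V:\mathbb R^{n_x}\to\mathbb R_{\ge0}$, $\alpha_w\in\mathcal K_\infty$ and parameters $\epsilon\in\mathbb R$, $\gamma,L>0$: $V$ is locally Lipschitz, and there exist a locally Lipschitz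 $W:\mathbb R^{n_x}\to\mathbb R_{\ge0}$, a continuous $H:\mathbb R^{n_x}\times\mathbb R^{n_x}\times\mathbb R^{n_w}\to\mathbb R_{\ge0}$ and $\underline\alpha_W,\overline\alpha_W,\underline\alpha_V,\overline\alpha_V\in\mathcal K_\infty$ with $\underline\alpha_W(|e|)\le W(e)\le\overline\alpha_W(|e|)$ for all $e$, $\underline\alpha_V(|x|)\le V(x)\le\overline\alpha_V(|x|)$ for all $x$, $$\langle\nabla W(e),g(x,e,w)\rangle\le LW(e)+H(x,e,w)\quad\text{for all }x,w\text{ and almost all }e,$$ $$\langle\nabla V(x),f(x,e,w)\rangle\le-\epsilon V(x)-H^2(x,e,w)+\gamma^2W^2(e)+\alpha_w(|w|)\quad\text{for all }e,w\text{ and almost all }x.$$ **Mechanism.** For $\gamma,\Lambda>0$ let $r=\sqrt{|(\gamma/\Lambda)^2-1|}$ and $$T_{\max}(\gamma,\Lambda)=\begin{cases}\frac1{\Lambda r}\arctan r,&\gamma>\Lambda,\\ \frac1\Lambda,&\gamma=\Lambda,\\ \frac1{\Lambda r}\operatorname{arctanh} r,&\gamma<\Lambda.\end{cases}$$ Let $m>1$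 be an integer, $n_\eta=m-1$, $\epsilon_{\mathrm{ref}}>0$, $\delta\in(0,1)$, $n_{\mathrm{par}}\ge1$, and let $(\epsilon_i,\gamma_i,L_i)$, $i=1,\dots,n_{\mathrm{par}}$, be given. Put $$C(x,\eta)=\frac1m\Big(V(x)+\sum_{k=1}^{m-1}\eta_k\Big),\qquad \Lambda_i=\max\{L_i+\tfrac{\epsilon_i}2,\,1-\delta\}.$$ $\Gamma(x,\eta)$ is the final value of $\bar h$ in the following algorithm: start with $\bar h=\delta T_{\max}(\gamma_1,L_1+\frac{\epsilon_1}2)$; for $i=2,\dots,n_{\mathrm{par}}$ compute, with $V=V(x)$, $C=C(x,\eta)$, $$\bar h_i=\begin{cases}\min\Big\{\delta T_{\max}(\gamma_i,\Lambda_i),\ \frac{\log C-\log V}{-\epsilon_i+\epsilon_{\mathrm{ref}}}\Big\},&C\ge V,\ \epsilon_i<\epsilon_{\mathrm{ref}},\\ \delta T_{\max}(\gamma_i,\Lambda_i),&C\ge V,\ \epsilon_i\ge\epsilon_{\mathrm{ref}},\\ 0,&C<V,\end{cases}$$ and replace $\bar h$ by $\bar h_i$ if $\bar h_i>\bar h$.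 (If $V=0\le C$, the quotient in the first case is read as $+\infty$.) The dynamic variable is updated by $$S(\eta,x)=e^{-\epsilon_{\mathrm{ref}}\Gamma(x,\eta)}\,(\eta_2,\dots,\eta_{m-1},V(x))^\top .$$ **Theorem.** Suppose that Assumption A holds for $(\epsilon_i,\gamma_i,L_i)$, $i=1,\dots,n_{\mathrm{par}}$, with the same $V$ and $\alpha_w$, and that $\epsilon_1>0$. Consider $\mathcal H_{STC}$ with the above $S$ and $\Gamma$. Then $t_{\min}:=\delta T_{\max}\big(\gamma_1,L_1+\frac{\epsilon_1}2\big)>0$, any two consecutive sampling instants $t_j,t_{j+1}$, $j\in\mathbb N_0$, of a solution satisfy $t_{j+1}-t_j\ge t_{\min}$, and $\mathcal H_{STC}$ is ISS. -/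

import Mathlib

open MeasureTheory Set Filter Topology
open scoped NNReal ENNReal

namespace STC

noncomputable section

/-! ### Comparison functions -/

/-- Class `𝒦`: continuous, strictly increasing, zero at zero. -/
structure IsClassK (α : ℝ≥0 → ℝ≥0) : Prop where
  continuous : Continuous α
  strictMono : StrictMono α
  map_zero : α 0 = 0

/-- Class `𝒦_∞`: class `𝒦` and unbounded. -/
structure IsClassKInf (α : ℝ≥0 → ℝ≥0) : Prop extends IsClassK α where
  unbounded : ¬ BddAbove (range α)

/-- Class `𝒦ℒ`: (jointly) continuous, class `𝒦` in the first argument, and nonincreasing with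
limit zero in the second one. -/
structure IsClassKL (β : ℝ≥0 → ℝ≥0 → ℝ≥0) : Prop where
  continuous : Continuous fun p : ℝ≥0 × ℝ≥0 => β p.1 p.2
  classK : ∀ t, IsClassK fun q => β q t
  antitone : ∀ q, Antitone (β q)
  tendsto_zero : ∀ q, Tendsto (β q) atTop (𝓝 0)

/-- Class `𝒦ℒℒ`: fixing either the third or the second argument leaves a class `𝒦ℒ` function. -/
structure IsClassKLL (β : ℝ≥0 → ℝ≥0 → ℝ≥0 → ℝ≥0) : Prop where
  left : ∀ r, IsClassKL fun q t => β q r t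
  right : ∀ r, IsClassKL fun q t => β q t r

/-! ### Hybrid systems and their solutions -/

/-- A compact hybrid time domain `⋃_{j < J} [t_j, t_{j+1}] × {j}` with
`0 = t_0 ≤ t_1 ≤ ⋯ ≤ t_J`. -/
def IsCompactHybridTimeDomain (D : Set (ℝ × ℕ)) : Prop :=
  ∃ (J : ℕ) (t : ℕ → ℝ), t 0 = 0 ∧ (∀ j < J, t j ≤ t (j + 1)) ∧
    D = ⋃ j ∈ Finset.range J, Icc (t j) (t (j + 1)) ×ˢ {j}

/-- A hybrid time domain: each truncation at one of its points is a compact one. -/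
def IsHybridTimeDomain (D : Set (ℝ × ℕ)) : Prop :=
  (∀ p ∈ D, 0 ≤ p.1) ∧
    ∀ p ∈ D, IsCompactHybridTimeDomain (D ∩ (Icc 0 p.1 ×ˢ Iic p.2))

/-- The data of the hybrid system `ξ' = F(ξ, w)` on the flow set, `ξ⁺ = G(ξ)` on the jump set. -/
structure HybridSystem (E Win : Type*) where
  flowMap : E → Win → E
  jumpMap : E → E
  flowSet : Set E
  jumpSet : Set E

/-- `(dom, ξ)` is a solution of the hybrid system `H` for the input `w : [0, ∞) → Win`
(the values of `w` at negative times and of `ξ` outside `dom` play no role):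
`ξ` is absolutely continuous in `t` on each compact interval of constant `j`, obeys the flow
at almost all times, and obeys the jump map at each jump. -/
structure IsSolution {E Win : Type*} [NormedAddCommGroup E] [NormedSpace ℝ E]
    (H : HybridSystem E Win) (w : ℝ → Win) (dom : Set (ℝ × ℕ)) (ξ : ℝ → ℕ → E) : Prop where
  timeDomain : IsHybridTimeDomain dom
  absCont : ∀ (j : ℕ) (a b : ℝ), a ≤ b → (a, j) ∈ dom → (b, j) ∈ dom →
    AbsolutelyContinuousOnInterval (fun t => ξ t j) a b
  flow : ∀ j : ℕ, ∀ᵐ t : ℝ, (t, j) ∈ dom →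
    ξ t j ∈ H.flowSet ∧ HasDerivAt (fun s => ξ s j) (H.flowMap (ξ t j) (w t)) t
  jump : ∀ (t : ℝ) (j : ℕ), (t, j) ∈ dom → (t, j + 1) ∈ dom →
    ξ t j ∈ H.jumpSet ∧ ξ t (j + 1) = H.jumpMap (ξ t j)

/-! ### The networked control system -/

/-- The combined state space of `x = (x_p, x_c)`, with the Euclidean norm. -/
abbrev Comb (nxp nxc : ℕ) : Type := EuclideanSpace ℝ (Fin nxp ⊕ Fin nxc)

/-- The plant component of a combined vector. -/
def plantPart {nxp nxc : ℕ} (x : Comb nxp nxc) : EuclideanSpace ℝ (Fin nxp) :=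
  WithLp.toLp 2 fun i => x (Sum.inl i)

/-- The controller component of a combined vector. -/
def ctrlPart {nxp nxc : ℕ} (x : Comb nxp nxc) : EuclideanSpace ℝ (Fin nxc) :=
  WithLp.toLp 2 fun i => x (Sum.inr i)

/-- The combined vector `(x_p, x_c)`. -/
def combine {nxp nxc : ℕ} (xp : EuclideanSpace ℝ (Fin nxp)) (xc : EuclideanSpace ℝ (Fin nxc)) :
    Comb nxp nxc :=
  WithLp.toLp 2 (Sum.elim (fun i => xp i) (fun i => xc i))

/-- The right-hand side `f(x, e, w)` of the sampled-data closed loop with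
`x̂_p = x_p + e_{x_p}`, `x̂_c = x_c + e_{x_c}` and `û = g_c(x̂_c, x̂_p)`. -/
def closedLoop {nxp nxc nu nw : ℕ}
    (fp : EuclideanSpace ℝ (Fin nxp) → EuclideanSpace ℝ (Fin nu) → EuclideanSpace ℝ (Fin nw) →
      EuclideanSpace ℝ (Fin nxp))
    (fc : EuclideanSpace ℝ (Fin nxc) → EuclideanSpace ℝ (Fin nxp) → EuclideanSpace ℝ (Fin nxc))
    (gc : EuclideanSpace ℝ (Fin nxc) → EuclideanSpace ℝ (Fin nxp) → EuclideanSpace ℝ (Fin nu))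
    (x e : Comb nxp nxc) (w : EuclideanSpace ℝ (Fin nw)) : Comb nxp nxc :=
  combine
    (fp (plantPart x) (gc (ctrlPart x + ctrlPart e) (plantPart x + plantPart e)) w)
    (fc (ctrlPart x) (plantPart x + plantPart e))

/-- The state space of `ξ = (x, e, η, τ, τ_max)`. -/
abbrev State (X : Type*) (nη : ℕ) : Type _ := X × X × EuclideanSpace ℝ (Fin nη) × ℝ × ℝ

namespace State

variable {X : Type*} {nη : ℕ}

/-- The plant and controller state. -/
def x (ξ : State X nη) : X := ξ.1

/-- The sampling-induced error. -/
def e (ξ : State X nη) : X := ξ.2.1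

/-- The dynamic variable. -/
def η (ξ : State X nη) : EuclideanSpace ℝ (Fin nη) := ξ.2.2.1

/-- The time since the last sampling instant. -/
def τ (ξ : State X nη) : ℝ := ξ.2.2.2.1

/-- The current sampling interval. -/
def τmax (ξ : State X nη) : ℝ := ξ.2.2.2.2

/-- The Euclidean norm of the stacked vector `(x, e, η)`. -/
def stackNorm [NormedAddCommGroup X] (ξ : State X nη) : ℝ≥0 :=
  NNReal.sqrt (‖ξ.x‖₊ ^ 2 + ‖ξ.e‖₊ ^ 2 + ‖ξ.η‖₊ ^ 2)

end State

/-- The hybrid system `H_STC` for the right-hand side `f`, the sampling-interval function `Γ` and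
the update `S` of the dynamic variable. -/
def hybridSTC {X Win : Type*} [NormedAddCommGroup X] {nη : ℕ} (f : X → X → Win → X)
    (S : EuclideanSpace ℝ (Fin nη) → X → EuclideanSpace ℝ (Fin nη))
    (Γ : X → EuclideanSpace ℝ (Fin nη) → ℝ) : HybridSystem (State X nη) Win where
  flowMap ξ w := (f ξ.x ξ.e w, -f ξ.x ξ.e w, 0, 1, 0)
  jumpMap ξ := (ξ.x, 0, S ξ.η ξ.x, 0, Γ ξ.x ξ.η)
  flowSet := {ξ | ξ.τ ≤ ξ.τmax}
  jumpSet := {ξ | ξ.τ = ξ.τmax}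

/-- Admissible initial conditions: `x, e, η` arbitrary, `τ_max = τ ≥ 0`, so that a sampling
takes place at time zero. -/
def AdmissibleInit {X : Type*} {nη : ℕ} (ξ₀ : State X nη) : Prop :=
  0 ≤ ξ₀.τ ∧ ξ₀.τmax = ξ₀.τ

/-- The `L_∞` norm of an input on `[0, ∞)`. -/
def inputNorm {Win : Type*} [NormedAddCommGroup Win] (w : ℝ → Win) : ℝ≥0∞ :=
  eLpNorm w ∞ (volume.restrict (Ici (0 : ℝ)))

/-- Input-to-state stability. For inputs with infinite `L_∞` norm the bound is void. -/
def IsISS {X Win : Type*} [NormedAddCommGroup X] [NormedSpace ℝ X] [NormedAddCommGroup Win]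
    {nη : ℕ} (H : HybridSystem (State X nη) Win) : Prop :=
  ∃ (β : ℝ≥0 → ℝ≥0 → ℝ≥0 → ℝ≥0) (ψ : ℝ≥0 → ℝ≥0), IsClassKLL β ∧ IsClassKInf ψ ∧
    ∀ (w : ℝ → Win), LocallyIntegrableOn w (Ici 0) → inputNorm w ≠ ∞ →
    ∀ (dom : Set (ℝ × ℕ)) (ξ : ℝ → ℕ → State X nη), IsSolution H w dom ξ →
      AdmissibleInit (ξ 0 0) →
      ∀ (t : ℝ) (j : ℕ), (t, j) ∈ dom →
        (ξ t j).stackNorm ≤ β (ξ 0 0).stackNorm t.toNNReal j + ψ (inputNorm w).toNNReal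

/-- `t` is the sampling instant `t_j`: the trajectory jumps from `s_j = (t_j, j)` to
`s_j⁺ = (t_j, j + 1)`. -/
def IsSamplingInstant (dom : Set (ℝ × ℕ)) (j : ℕ) (t : ℝ) : Prop :=
  (t, j) ∈ dom ∧ (t, j + 1) ∈ dom

/-! ### Hybrid Lyapunov functions and the triggering mechanism -/

/-- The hybrid Lyapunov assumption for `x' = f(x, e, w)`, `e' = -f(x, e, w)`, with given `V`, `α_w`
and given parameters `ε`, `γ`, `L`. The functions `W`, `H` and the bounds on `W`, `V` may depend
on the parameters. -/
def HybridLyapunovAssumption {X Win : Type*} [NormedAddCommGroup X] [InnerProductSpace ℝ X]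
    [CompleteSpace X] [MeasureSpace X] [NormedAddCommGroup Win]
    (f : X → X → Win → X) (V : X → ℝ) (αw : ℝ≥0 → ℝ≥0) (ε γ L : ℝ) : Prop :=
  0 < L ∧ 0 < γ ∧ LocallyLipschitz V ∧ IsClassKInf αw ∧
  ∃ (W : X → ℝ) (H : X → X → Win → ℝ) (αWlo αWup αVlo αVup : ℝ≥0 → ℝ≥0),
    LocallyLipschitz W ∧
    Continuous (fun p : X × X × Win => H p.1 p.2.1 p.2.2) ∧
    (∀ x e w, 0 ≤ H x e w) ∧
    IsClassKInf αWlo ∧ IsClassKInf αWup ∧ IsClassKInf αVlo ∧ IsClassKInf αVup ∧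
    (∀ e, (αWlo ‖e‖₊ : ℝ) ≤ W e ∧ W e ≤ αWup ‖e‖₊) ∧
    (∀ x, (αVlo ‖x‖₊ : ℝ) ≤ V x ∧ V x ≤ αVup ‖x‖₊) ∧
    (∀ x w, ∀ᵐ e, inner ℝ (gradient W e) (-f x e w) ≤ L * W e + H x e w) ∧
    (∀ e w, ∀ᵐ x, inner ℝ (gradient V x) (f x e w) ≤
      -ε * V x - H x e w ^ 2 + γ ^ 2 * W e ^ 2 + αw ‖w‖₊)

/-- The function `T_max(γ, Λ)`. -/
def Tmax (γ Λ : ℝ) : ℝ :=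
  let r := Real.sqrt |(γ / Λ) ^ 2 - 1|
  if Λ < γ then 1 / (Λ * r) * Real.arctan r
  else if γ = Λ then 1 / Λ
  else 1 / (Λ * r) * Real.artanh r

/-- The candidate sampling interval of a parameter set `(ε, γ, L)`, for the values `V` and `C`.
For `0 = V ≤ C` the constraint `(-ε + ε_ref) h ≤ log (C / V)`, which stands for
`exp (-ε h) V ≤ exp (-ε_ref h) C`, is void. -/
def candidate (δ εref ε γ L V C : ℝ) : ℝ :=
  let Λ := max (L + ε / 2) (1 - δ)
  if V ≤ C then
    if 0 < -ε + εref then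
      if V = 0 then δ * Tmax γ Λ
      else min (δ * Tmax γ Λ) ((Real.log C - Real.log V) / (-ε + εref))
    else δ * Tmax γ Λ
  else 0

/-- The fall-back sampling interval `δ T_max(γ₁, L₁ + ε₁ / 2)`; the index `0` is the distinguished
parameter set. -/
def fallback {N : ℕ} (δ : ℝ) (ε γ L : Fin (N + 1) → ℝ) : ℝ :=
  δ * Tmax (γ 0) (L 0 + ε 0 / 2)

/-- The sampling interval computed from the values `V` and `C`: start with the fall-back value, run
through the remaining parameter sets, and update whenever a candidate is larger. -/
def interval {N : ℕ} (δ εref : ℝ) (ε γ L : Fin (N + 1) → ℝ) (V C : ℝ) : ℝ :=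
  (List.finRange N).foldl
    (fun h i =>
      if h < candidate δ εref (ε i.succ) (γ i.succ) (L i.succ) V C then
        candidate δ εref (ε i.succ) (γ i.succ) (L i.succ) V C
      else h)
    (fallback δ ε γ L)

/-- `C(x, η) = (V(x) + ∑ η_k) / m`. -/
def firC {X : Type*} (m : ℕ) (V : X → ℝ) (x : X) (η : EuclideanSpace ℝ (Fin (m - 1))) : ℝ :=
  1 / (m : ℝ) * (V x + ∑ k, η k)

/-- `Γ(x, η)` for the FIR mechanism. -/
def firΓ {X : Type*} {N : ℕ} (m : ℕ) (V : X → ℝ) (δ εref : ℝ) (ε γ L : Fin (N + 1) → ℝ)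
    (x : X) (η : EuclideanSpace ℝ (Fin (m - 1))) : ℝ :=
  interval δ εref ε γ L (V x) (firC m V x η)

/-- `S(η, x) = exp (-ε_ref Γ(x, η)) (η_2, …, η_{m-1}, V(x))`. -/
def firS {X : Type*} {N : ℕ} (m : ℕ) (V : X → ℝ) (δ εref : ℝ) (ε γ L : Fin (N + 1) → ℝ)
    (η : EuclideanSpace ℝ (Fin (m - 1))) (x : X) : EuclideanSpace ℝ (Fin (m - 1)) :=
  WithLp.toLp 2 fun k =>
    Real.exp (-εref * firΓ m V δ εref ε γ L x η) *
      (if h : (k : ℕ) + 1 < m - 1 then η ⟨k + 1, h⟩ else V x)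

end

end STC

open STC

/-! Fix a parameter set `(ε, γ, L)` and `Λ ≥ L + ε/2`. Along a flow started with `e = 0`, consider
`U = V(x) + γ φ(τ) W(e)²`, where `φ ≥ 0` solves `φ' = -2Λφ - γ(φ² + 1)`. Completing a square gives
`U' ≤ -ε U + αw(|w|)`, and such a `φ` exists on `[0, δ Tmax γ Λ]` because `Tmax` is the time in
which the Riccati solution falls from `+∞` to `0`. So over such an interval `V` evolves with rate
`ε`, up to the disturbance (`lyapunov_flow_estimate`). As `V` and `W` are only locally Lipschitz,
with gradient bounds almost everywhere, `deriv_comp_le_of_ae_inner_gradient_le` transfers these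
bounds to trajectories.

The chosen interval `h` is either the fallback, with rate `ε 0 > 0`, or satisfies `exp(-ε_i h) V ≤
exp(-εref h) C` (`interval_spec`). The average `C` is at most `level`, the maximum of `V` and all
`|η_k|`, and the shift register `S` scales its entries by `exp(-εref h)`. Hence each sampling
multiplies `level` by at most `exp(-a h)`, `a = min εref (ε 0)`, up to a multiple of `αw(‖w‖)`. The
scan never goes below the fallback, which separates the sampling instants and makes the disturbance
terms a convergent geometric series (`exists_decay_bound`).

Between samplings `V` exceeds `level` by at most a constant factor and a disturbance term, and `e`
is a difference of two states with controlled `V`. The minimal spacing turns decay in `t` into decay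
in `t + j`, which gives ISS. -/

namespace STC

/-! ### Absolute continuity and a nonsmooth chain rule -/

section Analysis

theorem _root_.LipschitzOnWith.comp_absolutelyContinuousOnInterval {Y Z : Type*}
    [PseudoMetricSpace Y] [PseudoMetricSpace Z] {K : ℝ≥0} {g : Y → Z} {s : Set Y} {u : ℝ → Y}
    {a b : ℝ} (hg : LipschitzOnWith K g s) (hu : AbsolutelyContinuousOnInterval u a b)
    (hus : ∀ t ∈ uIcc a b, u t ∈ s) :
    AbsolutelyContinuousOnInterval (fun t => g (u t)) a b := by
  rw [absolutelyContinuousOnInterval_iff] at hu ⊢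
  intro ε hε
  obtain ⟨d, hd, H⟩ := hu (ε / (K + 1)) (by positivity)
  refine ⟨d, hd, fun E hE hlt => ?_⟩
  have h1 := H E hE hlt
  rw [lt_div_iff₀ (by positivity)] at h1
  calc ∑ i ∈ Finset.range E.1, dist (g (u (E.2 i).1)) (g (u (E.2 i).2))
      ≤ ∑ i ∈ Finset.range E.1, K * dist (u (E.2 i).1) (u (E.2 i).2) := by
        refine Finset.sum_le_sum fun i hi => ?_
        exact hg.dist_le_mul _ (hus _ (hE.1 i hi).1) _ (hus _ (hE.1 i hi).2)
    _ = (∑ i ∈ Finset.range E.1, dist (u (E.2 i).1) (u (E.2 i).2)) * K := by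
        rw [← Finset.mul_sum, mul_comm]
    _ ≤ (∑ i ∈ Finset.range E.1, dist (u (E.2 i).1) (u (E.2 i).2)) * (K + 1) := by
        refine mul_le_mul_of_nonneg_left (by linarith) (Finset.sum_nonneg fun _ _ => dist_nonneg)
    _ < ε := h1

theorem _root_.LipschitzWith.comp_absolutelyContinuousOnInterval {Y Z : Type*}
    [PseudoMetricSpace Y] [PseudoMetricSpace Z] {K : ℝ≥0} {g : Y → Z} {u : ℝ → Y}
    {a b : ℝ} (hg : LipschitzWith K g) (hu : AbsolutelyContinuousOnInterval u a b) :
    AbsolutelyContinuousOnInterval (fun t => g (u t)) a b :=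
  (lipschitzOnWith_univ.2 hg).comp_absolutelyContinuousOnInterval hu fun _ _ => mem_univ _

theorem _root_.LocallyLipschitz.comp_absolutelyContinuousOnInterval {Y : Type*}
    [SeminormedAddCommGroup Y] {g : Y → ℝ} {u : ℝ → Y}
    {a b : ℝ} (hg : LocallyLipschitz g) (hu : AbsolutelyContinuousOnInterval u a b) :
    AbsolutelyContinuousOnInterval (fun t => g (u t)) a b := by
  have hc : IsCompact (u '' uIcc a b) := isCompact_uIcc.image_of_continuousOn hu.continuousOn
  obtain ⟨K, hK⟩ := (hg.locallyLipschitzOn (s := u '' uIcc a b)).exists_lipschitzOnWith_of_compact hc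
  exact hK.comp_absolutelyContinuousOnInterval hu fun t ht => mem_image_of_mem _ ht

/-- An absolutely continuous function whose derivative is a.e. at most `c` grows at most linearly
with slope `c`. -/
theorem _root_.AbsolutelyContinuousOnInterval.sub_le_of_ae_deriv_le {G : ℝ → ℝ} {a b c : ℝ}
    (hab : a ≤ b) (hG : AbsolutelyContinuousOnInterval G a b)
    (h : ∀ᵐ t : ℝ, t ∈ Icc a b → ∀ d, HasDerivAt G d t → d ≤ c) :
    G b - G a ≤ c * (b - a) := by
  rw [← hG.integral_deriv_eq_sub]
  have : ∫ x in a..b, deriv G x ≤ ∫ _ in a..b, c := by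
    refine intervalIntegral.integral_mono_ae_restrict hab hG.intervalIntegrable_deriv
      intervalIntegrable_const ?_
    rw [Filter.EventuallyLE, ae_restrict_iff' measurableSet_Icc]
    filter_upwards [h, hG.ae_differentiableAt] with t h1 h2 ht
    exact h1 ht _ (h2 (by rwa [uIcc_of_le hab])).hasDerivAt
  simpa [mul_comm] using this

variable {X : Type*} [NormedAddCommGroup X] [InnerProductSpace ℝ X] [FiniteDimensional ℝ X]
  [MeasurableSpace X] [BorelSpace X] (μ : Measure X) [μ.IsAddHaarMeasure]

/-- By Fubini, almost every line parallel to `v` stays in the good set for almost all times. On such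
a line `W` is absolutely continuous and its derivative can be integrated. Base points of such lines
are dense, so continuity of `W` gives the bound at `e` itself. -/
theorem add_smul_le_of_ae_inner_gradient_le {W : X → ℝ} {e v : X} {ρ c : ℝ} {K : ℝ≥0}
    (hW : LipschitzOnWith K W (Metric.ball e ρ))
    (hgrad : ∀ᵐ y ∂μ, y ∈ Metric.ball e ρ → inner ℝ (gradient W y) v ≤ c)
    {h : ℝ} (hh : 0 ≤ h) (hv : h * ‖v‖ < ρ) :
    W (e + h • v) ≤ W e + h * c := by
  have hρ : 0 < ρ := lt_of_le_of_lt (by positivity) hv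
  have hdiff : ∀ᵐ y ∂μ, y ∈ Metric.ball e ρ → DifferentiableAt ℝ W y := by
    filter_upwards [hW.ae_differentiableWithinAt_of_mem (μ := μ)] with y hy hyb
    exact (hy hyb).differentiableAt (Metric.isOpen_ball.mem_nhds hyb)
  obtain ⟨s, hs, hsm, hsp⟩ := (hgrad.and hdiff).exists_measurable_mem
  let Λ : ℝ →L[ℝ] X := ContinuousLinearMap.smulRight (1 : ℝ →L[ℝ] ℝ) v
  have hline : ∀ᵐ y ∂μ, ∀ᵐ t : ℝ, y + t • v ∈ s := by
    have := (ae_ae_add_linearMap_mem_iff Λ.toLinearMap volume μ hsm).2 hs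
    simpa [Λ] using this
  have hdense : ∃ᶠ y in 𝓝 e, ∀ᵐ t : ℝ, y + t • v ∈ s :=
    mem_closure_iff_frequently.1 ((Measure.dense_of_ae hline) e)
  have hball : ∀ᶠ y in 𝓝 e, y ∈ Metric.ball e (ρ - h * ‖v‖) :=
    Metric.ball_mem_nhds _ (by linarith)
  have hev : e + h • v ∈ Metric.ball e ρ := by
    simpa [norm_smul, abs_of_nonneg hh] using hv
  have hcont : ContinuousAt (fun y => W (y + h • v) - W y) e := by
    refine ContinuousAt.sub ?_ ?_
    · exact ContinuousAt.comp (f := fun y => y + h • v) (g := W)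
        (hW.continuousOn.continuousAt (Metric.isOpen_ball.mem_nhds hev)) (by fun_prop)
    · exact hW.continuousOn.continuousAt (Metric.ball_mem_nhds _ hρ)
  have key : W (e + h • v) - W e ≤ h * c := by
    refine le_of_tendsto_of_frequently hcont.tendsto ?_
    refine (hdense.and_eventually hball).mono fun y hy => ?_
    obtain ⟨hy, hyb⟩ := hy
    have hmem : ∀ t ∈ uIcc 0 h, y + t • v ∈ Metric.ball e ρ := by
      intro t ht
      rw [uIcc_of_le hh] at ht
      rw [Metric.mem_ball, dist_eq_norm] at hyb ⊢
      calc ‖y + t • v - e‖ ≤ ‖y - e‖ + ‖t • v‖ := by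
            rw [show y + t • v - e = (y - e) + t • v by abel]; exact norm_add_le _ _
        _ ≤ ‖y - e‖ + h * ‖v‖ := by
            rw [norm_smul, Real.norm_of_nonneg ht.1]; gcongr; exact ht.2
        _ < ρ := by linarith
    have hlin : AbsolutelyContinuousOnInterval (fun t : ℝ => y + t • v) 0 h := by
      refine ContDiffOn.absolutelyContinuousOnInterval ?_
      fun_prop
    have hAC := hW.comp_absolutelyContinuousOnInterval hlin hmem
    have := hAC.sub_le_of_ae_deriv_le hh (c := c) (by
      filter_upwards [hy] with t ht htI d hd
      rw [← uIcc_of_le hh] at htI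
      obtain ⟨h1, h2⟩ := hsp _ ht
      have h3 := (h2 (hmem t htI)).hasGradientAt.hasFDerivAt
      have h4 : HasDerivAt (fun t : ℝ => y + t • v) v t := by
        simpa using ((hasDerivAt_id t).smul_const v).const_add y
      have h5 := h3.comp_hasDerivAt t h4
      rw [hd.unique h5]
      simpa using h1 (hmem t htI))
    simpa [mul_comm] using this
  linarith

/-- Chain rule inequality for a locally Lipschitz function whose gradient satisfies a differential
inequality almost everywhere: the inequality persists along every curve with the given velocity. -/
theorem deriv_comp_le_of_ae_inner_gradient_le {W : X → ℝ} (hW : LocallyLipschitz W)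
    {F : X → X} {R : X → ℝ} (hF : Continuous F) (hR : Continuous R)
    (h : ∀ᵐ y ∂μ, inner ℝ (gradient W y) (F y) ≤ R y)
    {u : ℝ → X} {t d : ℝ} (hu : HasDerivAt u (F (u t)) t)
    (hd : HasDerivAt (fun s => W (u s)) d t) : d ≤ R (u t) := by
  refine le_of_forall_pos_le_add fun η hη => ?_
  set e := u t
  set v := F e
  obtain ⟨K, s, hs, hK⟩ := hW e
  have hev1 : ∀ᶠ y in 𝓝 e, R y < R e + η / 2 :=
    hR.continuousAt.eventually (gt_mem_nhds (by linarith))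
  have hev2 : ∀ᶠ y in 𝓝 e, ‖F y - v‖ < η / (2 * (K + 1)) := by
    have : Tendsto (fun y => ‖F y - v‖) (𝓝 e) (𝓝 ‖F e - v‖) := by
      exact ((hF.sub continuous_const).norm).continuousAt
    exact this.eventually (gt_mem_nhds (by simp [v]; positivity))
  obtain ⟨ρ, hρ, hball⟩ := Metric.mem_nhds_iff.1 (inter_mem hs (hev1.and hev2))
  have hKb : LipschitzOnWith K W (Metric.ball e ρ) := hK.mono fun y hy => (hball hy).1
  -- Freezing the direction at `v = F e` costs at most `η`: half from the continuity of `R`, half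
  -- from that of `F`, since the gradient is bounded by `K`.
  have hgrad : ∀ᵐ y ∂μ, y ∈ Metric.ball e ρ → inner ℝ (gradient W y) v ≤ R e + η := by
    filter_upwards [h] with y hy hyb
    have hn : ‖gradient W y‖ ≤ K := by
      rw [gradient, LinearIsometryEquiv.norm_map]
      exact norm_fderiv_le_of_lipschitzOn ℝ (Metric.isOpen_ball.mem_nhds hyb) hKb
    obtain ⟨h1, h2⟩ := (hball hyb).2
    have h3 : inner ℝ (gradient W y) (v - F y) ≤ η / 2 := by
      calc inner ℝ (gradient W y) (v - F y) ≤ ‖gradient W y‖ * ‖v - F y‖ := real_inner_le_norm _ _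
        _ ≤ (K + 1) * (η / (2 * (K + 1))) := by
            rw [norm_sub_rev]
            exact mul_le_mul (by linarith) h2.le (norm_nonneg _) (by positivity)
        _ = η / 2 := by field_simp
    have h4 : inner ℝ (gradient W y) v
        = inner ℝ (gradient W y) (F y) + inner ℝ (gradient W y) (v - F y) := by
      rw [← inner_add_right]; congr 1; abel
    have h1 : R y < R e + η / 2 := h1
    linarith
  have hdt := (hasDerivAt_iff_tendsto_slope_zero.1 hd).mono_left (nhdsGT_le_nhdsNE 0)
  have hut := (hasDerivAt_iff_tendsto_slope_zero.1 hu).mono_left (nhdsGT_le_nhdsNE 0)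
  -- The curve differs from the straight line `e + r • v` by `o(r)`, so the Lipschitz bound makes
  -- the error in the difference quotient vanish.
  have hlim : Tendsto (fun r : ℝ => (R e + η) + K * ‖r⁻¹ • (u (t + r) - u t) - v‖) (𝓝[>] 0)
      (𝓝 ((R e + η) + K * ‖v - v‖)) := ((hut.sub_const v).norm.const_mul _).const_add _
  rw [sub_self, norm_zero, mul_zero, add_zero] at hlim
  refine le_of_tendsto_of_tendsto hdt hlim ?_
  have hsmall1 : ∀ᶠ r : ℝ in 𝓝[>] 0, r * ‖v‖ < ρ := by
    have : Tendsto (fun r : ℝ => r * ‖v‖) (𝓝 0) (𝓝 (0 * ‖v‖)) :=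
      (continuous_id.mul continuous_const).continuousAt
    rw [zero_mul] at this
    exact (this.mono_left nhdsWithin_le_nhds).eventually (gt_mem_nhds hρ)
  have hsmall2 : ∀ᶠ r : ℝ in 𝓝[>] 0, u (t + r) ∈ Metric.ball e ρ := by
    have h1 : Tendsto (fun r : ℝ => t + r) (𝓝 0) (𝓝 t) := by
      exact Continuous.tendsto' (by fun_prop) _ _ (add_zero t)
    exact ((hu.continuousAt.tendsto.comp h1).mono_left nhdsWithin_le_nhds).eventually
      (Metric.ball_mem_nhds _ hρ)
  filter_upwards [hsmall1, hsmall2, self_mem_nhdsWithin] with r h1 h2 (hr : 0 < r)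
  have h3 := add_smul_le_of_ae_inner_gradient_le μ hKb hgrad hr.le h1
  have h4 : e + r • v ∈ Metric.ball e ρ := by
    simpa [norm_smul, abs_of_pos hr] using h1
  have h5 := hKb.dist_le_mul _ h2 _ h4
  have h6 : dist (u (t + r)) (e + r • v) = r * ‖r⁻¹ • (u (t + r) - u t) - v‖ := by
    rw [dist_eq_norm, ← Real.norm_of_nonneg hr.le, ← norm_smul, smul_sub, Real.norm_of_nonneg hr.le,
      smul_inv_smul₀ hr.ne']
    congr 1; simp only [e]; abel
  rw [h6, Real.dist_eq] at h5
  have h7 := le_abs_self (W (u (t + r)) - W (e + r • v))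
  rw [smul_eq_mul, inv_mul_le_iff₀ hr]
  have : W (u t) = W e := rfl
  nlinarith

end Analysis
-- The Riccati equation behind `Tmax`
section Riccati

/-- The substitution `φ = (s'/s - Λ)/γ` linearizes the Riccati equation to `s'' = -(γ² - Λ²) s`.
With `s 0 = 0` the solution is a sine, the identity or a hyperbolic sine, and `Tmax` is the time at
which `s' = Λ s`, that is, `φ = 0`. -/
theorem exists_fundamental_pair {γ Λ : ℝ} (hγ : 0 < γ) (hΛ : 0 < Λ) :
    0 < Tmax γ Λ ∧ ∃ s s' : ℝ → ℝ, (∀ t, HasDerivAt s (s' t) t) ∧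
      (∀ t, HasDerivAt s' (-(γ ^ 2 - Λ ^ 2) * s t) t) ∧
      ∀ t ∈ Ioc 0 (Tmax γ Λ), 0 < s t ∧ Λ * s t ≤ s' t := by
  rcases lt_trichotomy Λ γ with h | h | h
  · have h1 : 1 < γ / Λ := (one_lt_div hΛ).2 h
    have hpos : 0 < (γ / Λ) ^ 2 - 1 := by nlinarith
    obtain ⟨r, hr⟩ : ∃ r, r = √|(γ / Λ) ^ 2 - 1| := ⟨_, rfl⟩
    have hr0 : 0 < r := by rw [hr, abs_of_pos hpos]; exact Real.sqrt_pos.2 hpos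
    have hr2 : (Λ * r) ^ 2 = γ ^ 2 - Λ ^ 2 := by
      rw [hr, abs_of_pos hpos, mul_pow, Real.sq_sqrt hpos.le]; field_simp
    have hT : Tmax γ Λ = 1 / (Λ * r) * Real.arctan r := by simp [Tmax, h, hr]
    have hω : 0 < Λ * r := mul_pos hΛ hr0
    have hat : 0 < Real.arctan r := Real.arctan_pos.2 hr0
    refine ⟨by rw [hT]; positivity, fun t => Real.sin (Λ * r * t),
      fun t => Λ * r * Real.cos (Λ * r * t), fun t => ?_, fun t => ?_, fun t ht => ?_⟩
    · have := ((hasDerivAt_id t).const_mul (Λ * r)).sin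
      simpa [mul_comm] using this
    · have := (((hasDerivAt_id t).const_mul (Λ * r)).cos).const_mul (Λ * r)
      refine this.congr_deriv ?_
      rw [← hr2]; simp; ring
    · have hx0 : 0 < Λ * r * t := mul_pos hω ht.1
      have hx1 : Λ * r * t ≤ Real.arctan r := by
        have := mul_le_mul_of_nonneg_left ht.2 hω.le
        rwa [hT, ← mul_assoc, mul_one_div_cancel hω.ne', one_mul] at this
      have hx2 : Real.arctan r < Real.pi / 2 := Real.arctan_lt_pi_div_two r
      have hcos : 0 < Real.cos (Λ * r * t) :=
        Real.cos_pos_of_mem_Ioo ⟨by linarith [Real.pi_pos], by linarith⟩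
      refine ⟨Real.sin_pos_of_pos_of_lt_pi hx0 (by linarith [Real.pi_pos]), ?_⟩
      have htan : Real.tan (Λ * r * t) ≤ r := by
        refine le_of_le_of_eq ?_ (Real.tan_arctan r)
        exact Real.strictMonoOn_tan.monotoneOn ⟨by linarith [Real.pi_pos], by linarith⟩
          ⟨by linarith [Real.pi_pos], by linarith⟩ hx1
      rw [Real.tan_eq_sin_div_cos, div_le_iff₀ hcos] at htan
      nlinarith
  · subst h
    have hT : Tmax Λ Λ = 1 / Λ := by simp [Tmax]
    refine ⟨by rw [hT]; positivity, fun t => t, fun _ => 1, fun t => hasDerivAt_id t,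
      fun t => by simpa using hasDerivAt_const t (1 : ℝ), fun t ht => ⟨ht.1, ?_⟩⟩
    have := ht.2
    rwa [hT, le_div_iff₀ hΛ, mul_comm] at this
  · have h1 : γ / Λ < 1 := (div_lt_one hΛ).2 h
    have h0 : 0 < γ / Λ := by positivity
    have hpos : 0 < 1 - (γ / Λ) ^ 2 := by nlinarith
    obtain ⟨r, hr⟩ : ∃ r, r = √|(γ / Λ) ^ 2 - 1| := ⟨_, rfl⟩
    rw [abs_sub_comm, abs_of_pos hpos] at hr
    have hr0 : 0 < r := by rw [hr]; exact Real.sqrt_pos.2 hpos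
    have hr1 : r < 1 := by
      rw [hr, Real.sqrt_lt' one_pos]; nlinarith
    have hr2 : (Λ * r) ^ 2 = Λ ^ 2 - γ ^ 2 := by
      rw [hr, mul_pow, Real.sq_sqrt hpos.le]; field_simp
    have hT : Tmax γ Λ = 1 / (Λ * r) * Real.artanh r := by
      simp only [Tmax, not_lt.2 h.le, h.ne, if_false]
      rw [abs_sub_comm, abs_of_pos hpos, ← hr]
    have hω : 0 < Λ * r := mul_pos hΛ hr0
    have hat : 0 < Real.artanh r := Real.artanh_pos ⟨hr0, hr1⟩
    refine ⟨by rw [hT]; positivity, fun t => Real.sinh (Λ * r * t),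
      fun t => Λ * r * Real.cosh (Λ * r * t), fun t => ?_, fun t => ?_, fun t ht => ?_⟩
    · have := ((hasDerivAt_id t).const_mul (Λ * r)).sinh
      simpa [mul_comm] using this
    · have := (((hasDerivAt_id t).const_mul (Λ * r)).cosh).const_mul (Λ * r)
      refine this.congr_deriv ?_
      rw [neg_sub, ← hr2]; simp; ring
    · have hx0 : 0 < Λ * r * t := mul_pos hω ht.1
      have hx1 : Λ * r * t ≤ Real.artanh r := by
        have := mul_le_mul_of_nonneg_left ht.2 hω.le
        rwa [hT, ← mul_assoc, mul_one_div_cancel hω.ne', one_mul] at this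
      refine ⟨Real.sinh_pos_iff.2 hx0, ?_⟩
      have htanh : Real.tanh (Λ * r * t) ≤ r := by
        rw [← Real.artanh_le_artanh_iff ⟨Real.neg_one_lt_tanh _, Real.tanh_lt_one _⟩
          ⟨by linarith, hr1⟩, Real.artanh_tanh]
        exact hx1
      rw [Real.tanh_eq_sinh_div_cosh, div_le_iff₀ (Real.cosh_pos _)] at htanh
      nlinarith

theorem Tmax_pos {γ Λ : ℝ} (hγ : 0 < γ) (hΛ : 0 < Λ) : 0 < Tmax γ Λ :=
  (exists_fundamental_pair hγ hΛ).1

/-- On `[0, δ T_max]` the Riccati equation `φ' = -2 Λ φ - γ (φ² + 1)` has a nonnegative solution. -/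
theorem exists_riccati_solution {γ Λ δ : ℝ} (hγ : 0 < γ) (hΛ : 0 < Λ) (hδ : δ < 1) :
    ∃ φ : ℝ → ℝ, ∀ t ∈ Icc 0 (δ * Tmax γ Λ), 0 ≤ φ t ∧
      HasDerivAt φ (-2 * Λ * φ t - γ * (φ t ^ 2 + 1)) t := by
  obtain ⟨hT, s, s', hs, hs', hpos⟩ := exists_fundamental_pair hγ hΛ
  set T := Tmax γ Λ
  -- The shift by `(1 - δ) T` avoids the pole of `s'/s` at `0`; this is where `δ < 1` is needed.
  refine ⟨fun t => (s' (t + (1 - δ) * T) / s (t + (1 - δ) * T) - Λ) / γ, fun t ht => ?_⟩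
  have hσ : 0 < (1 - δ) * T := mul_pos (by linarith) hT
  obtain ⟨h1, h2⟩ := hpos (t + (1 - δ) * T) ⟨by linarith [ht.1], by linarith [ht.2]⟩
  refine ⟨div_nonneg (sub_nonneg.2 ((le_div_iff₀ h1).2 h2)) hγ.le, ?_⟩
  have d1 := (hs (t + (1 - δ) * T)).comp_add_const t ((1 - δ) * T)
  have d2 := (hs' (t + (1 - δ) * T)).comp_add_const t ((1 - δ) * T)
  refine (((d2.div d1 h1.ne').sub_const Λ).div_const γ).congr_deriv ?_
  have := h1.ne'
  field_simp
  ring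

theorem _root_.AbsolutelyContinuousOnInterval.of_hasDerivAt {φ φ' : ℝ → ℝ} {a b : ℝ}
    (hφ : ∀ t ∈ uIcc a b, HasDerivAt φ (φ' t) t) (hc : ContinuousOn φ' (uIcc a b)) :
    AbsolutelyContinuousOnInterval φ a b := by
  obtain ⟨C, hC⟩ := isCompact_uIcc.exists_bound_of_continuousOn hc
  refine LipschitzOnWith.absolutelyContinuousOnInterval (K := C.toNNReal) ?_
  refine Convex.lipschitzOnWith_of_nnnorm_hasDerivWithin_le (f' := φ') (convex_uIcc a b)
    (fun t ht => (hφ t ht).hasDerivWithinAt) fun t ht => ?_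
  rw [← NNReal.coe_le_coe, coe_nnnorm]
  exact (hC t ht).trans (Real.le_coe_toNNReal C)

end Riccati

/-! ### The Lyapunov estimate along a flow interval -/

section FlowEstimate

variable {X Win : Type*} [NormedAddCommGroup X] [InnerProductSpace ℝ X] [FiniteDimensional ℝ X]
  [MeasureSpace X] [BorelSpace X] [(volume : Measure X).IsAddHaarMeasure]
  [NormedAddCommGroup Win]

/-- Along a flow interval starting with zero error and no longer than `δ T_max(γ, Λ)`, the function
`V` obeys an exponential bound with rate `ε`. -/
theorem lyapunov_flow_estimate {f : X → X → Win → X}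
    (hf : Continuous fun p : X × X × Win => f p.1 p.2.1 p.2.2)
    {V : X → ℝ} {αw : ℝ≥0 → ℝ≥0} {ε γ L Λ δ : ℝ}
    (hA : HybridLyapunovAssumption f V αw ε γ L) (hΛ : 0 < Λ) (hLΛ : L + ε / 2 ≤ Λ) (hδ : δ < 1)
    {x e : ℝ → X} {w : ℝ → Win} {ω : ℝ≥0} {a b : ℝ} (hab : a ≤ b)
    (hb : b - a ≤ δ * Tmax γ Λ)
    (hx : AbsolutelyContinuousOnInterval x a b) (he : AbsolutelyContinuousOnInterval e a b)
    (hflow : ∀ᵐ t : ℝ, t ∈ Icc a b → HasDerivAt x (f (x t) (e t) (w t)) t ∧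
      HasDerivAt e (-f (x t) (e t) (w t)) t)
    (hw : ∀ᵐ t : ℝ, t ∈ Icc a b → ‖w t‖₊ ≤ ω) (hea : e a = 0) :
    V (x b) ≤ Real.exp (-ε * (b - a)) * V (x a) +
      Real.exp (2 * |ε| * Tmax γ Λ) * Tmax γ Λ * αw ω := by
  obtain ⟨hL, hγ, hV, hαw, W, H, αWlo, αWup, αVlo, αVup, hW, hH, hH0, hWlo, hWup, hVlo, hVup,
    hWb, hVb, hWd, hVd⟩ := hA
  obtain ⟨φ, hφ⟩ := exists_riccati_solution hγ hΛ hδ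
  have hT := Tmax_pos hγ hΛ
  set T := Tmax γ Λ
  have hbT : b - a ≤ T := hb.trans (by nlinarith)
  have hW0 : ∀ y, 0 ≤ W y := fun y => (NNReal.coe_nonneg _).trans (hWb y).1
  have hWz : W 0 = 0 := by
    refine le_antisymm ?_ (hW0 0)
    simpa [hWup.map_zero] using (hWb 0).2
  have hφI : ∀ t ∈ Icc a b, 0 ≤ φ (t - a) ∧
      HasDerivAt (fun t => φ (t - a)) (-2 * Λ * φ (t - a) - γ * (φ (t - a) ^ 2 + 1)) t := by
    intro t ht
    obtain ⟨h1, h2⟩ := hφ (t - a) ⟨by linarith [ht.1], by linarith [ht.2]⟩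
    exact ⟨h1, h2.comp_sub_const t a⟩
  have huI : uIcc a b = Icc a b := uIcc_of_le hab
  have hφc : ContinuousOn (fun t => φ (t - a)) (Icc a b) := fun t ht =>
    (hφI t ht).2.continuousAt.continuousWithinAt
  have hφAC : AbsolutelyContinuousOnInterval (fun t => φ (t - a)) a b := by
    refine AbsolutelyContinuousOnInterval.of_hasDerivAt (fun t ht => (hφI t (huI ▸ ht)).2) ?_
    rw [huI]
    exact (continuousOn_const.mul hφc).sub
      (continuousOn_const.mul ((hφc.pow 2).add continuousOn_const))
  have hEAC : AbsolutelyContinuousOnInterval (fun t => Real.exp (ε * (t - a))) a b := by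
    refine ContDiffOn.absolutelyContinuousOnInterval ?_
    fun_prop
  have hVAC := hV.comp_absolutelyContinuousOnInterval hx
  have hWAC := hW.comp_absolutelyContinuousOnInterval he
  -- The weight `exp (ε (t - a))` removes the term `-ε U`, so that only the disturbance drives the
  -- growth of `G`.
  set G : ℝ → ℝ := fun t =>
    Real.exp (ε * (t - a)) * (V (x t) + γ * (φ (t - a) * (W (e t) * W (e t)))) with hG
  have hGAC : AbsolutelyContinuousOnInterval G a b :=
    hEAC.fun_mul (hVAC.fun_add ((hφAC.fun_mul (hWAC.fun_mul hWAC)).const_mul γ))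
  have hGd := hGAC.sub_le_of_ae_deriv_le hab (c := Real.exp (|ε| * T) * αw ω) (by
    filter_upwards [hflow, hw, hVAC.ae_differentiableAt, hWAC.ae_differentiableAt] with
      t h1 h2 h3 h4 ht d hd
    obtain ⟨hx', he'⟩ := h1 ht
    have hdV := (h3 (huI ▸ ht)).hasDerivAt
    have hdW := (h4 (huI ▸ ht)).hasDerivAt
    set dV := deriv (fun t => V (x t)) t
    set dW := deriv (fun t => W (e t)) t
    obtain ⟨hp, hdφ⟩ := hφI t ht
    have hexp : HasDerivAt (fun t => Real.exp (ε * (t - a))) (Real.exp (ε * (t - a)) * ε) t := by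
      simpa using (((hasDerivAt_id t).sub_const a).const_mul ε).exp
    have hd' := hexp.mul (hdV.add ((hdφ.mul (hdW.mul hdW)).const_mul γ))
    rw [hd.unique hd']
    have hVle : dV ≤ -ε * V (x t) - H (x t) (e t) (w t) ^ 2 + γ ^ 2 * W (e t) ^ 2
        + αw ‖w t‖₊ := by
      refine deriv_comp_le_of_ae_inner_gradient_le (volume : Measure X) hV
        (F := fun y => f y (e t) (w t))
        (R := fun y => -ε * V y - H y (e t) (w t) ^ 2 + γ ^ 2 * W (e t) ^ 2 + αw ‖w t‖₊)
        (hf.comp (by fun_prop : Continuous fun y => (y, e t, w t))) ?_ (hVd (e t) (w t)) hx' hdV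
      have h5 : Continuous fun y => H y (e t) (w t) :=
        hH.comp (by fun_prop : Continuous fun y => (y, e t, w t))
      have h6 := hV.continuous
      fun_prop
    have hWle : dW ≤ L * W (e t) + H (x t) (e t) (w t) := by
      refine deriv_comp_le_of_ae_inner_gradient_le (volume : Measure X) hW
        (F := fun y => -f (x t) y (w t)) (R := fun y => L * W y + H (x t) y (w t))
        (hf.comp (by fun_prop : Continuous fun y => (x t, y, w t))).neg ?_
        (hWd (x t) (w t)) he' hdW
      have h5 : Continuous fun y => H (x t) y (w t) :=
        hH.comp (by fun_prop : Continuous fun y => (x t, y, w t))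
      have h6 := hW.continuous
      fun_prop
    have hα : (αw ‖w t‖₊ : ℝ) ≤ αw ω := NNReal.coe_le_coe.2 (hαw.strictMono.monotone (h2 ht))
    simp only [Pi.add_apply, Pi.mul_apply]
    set E := Real.exp (ε * (t - a))
    have hE0 : 0 < E := Real.exp_pos _
    have hE : E ≤ Real.exp (|ε| * T) := by
      refine Real.exp_le_exp.2 ?_
      calc ε * (t - a) ≤ |ε| * (t - a) :=
            mul_le_mul_of_nonneg_right (le_abs_self _) (by linarith [ht.1])
        _ ≤ |ε| * T := mul_le_mul_of_nonneg_left (by linarith [ht.2]) (abs_nonneg _)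
    have hWt := hW0 (e t)
    generalize H (x t) (e t) (w t) = h at *
    generalize φ (t - a) = p at *
    generalize V (x t) = v at *
    generalize W (e t) = q at *
    have hq : γ * p * q * dW ≤ γ * p * q * (L * q + h) :=
      mul_le_mul_of_nonneg_left hWle (by positivity)
    have hpq : γ * p * q ^ 2 * (L + ε / 2) ≤ γ * p * q ^ 2 * Λ :=
      mul_le_mul_of_nonneg_left hLΛ (by positivity)
    -- Inserting the bounds on `dV` and `dW` leaves `2γpq² (L + ε/2 - Λ) - (h - γpq)² + αw ω`, whose
    -- first two terms are nonpositive.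
    have key : ε * (v + γ * (p * (q * q))) + (dV + γ * ((-2 * Λ * p - γ * (p ^ 2 + 1)) * (q * q)
        + p * (dW * q + q * dW))) ≤ αw ω := by
      nlinarith [sq_nonneg (h - γ * p * q)]
    calc _ = E * (ε * (v + γ * (p * (q * q))) + (dV + γ * ((-2 * Λ * p - γ * (p ^ 2 + 1)) * (q * q)
        + p * (dW * q + q * dW)))) := by ring
      _ ≤ E * αw ω := mul_le_mul_of_nonneg_left key hE0.le
      _ ≤ _ := mul_le_mul_of_nonneg_right hE (NNReal.coe_nonneg _))
  have hGa : G a = V (x a) := by simp [hG, hea, hWz]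
  have hGb : Real.exp (ε * (b - a)) * V (x b) ≤ G b := by
    refine mul_le_mul_of_nonneg_left ?_ (Real.exp_pos _).le
    have := (hφI b ⟨hab, le_rfl⟩).1
    have : 0 ≤ γ * (φ (b - a) * (W (e b) * W (e b))) := by
      have := hW0 (e b)
      positivity
    linarith
  have h1 : Real.exp (ε * (b - a)) * V (x b) ≤
      V (x a) + Real.exp (|ε| * T) * T * αw ω := by
    have : Real.exp (|ε| * T) * αw ω * (b - a) ≤ Real.exp (|ε| * T) * αw ω * T :=
      mul_le_mul_of_nonneg_left hbT (by positivity)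
    linarith
  -- The factor `exp (|ε| T)` enters twice, in integrating with the weight and in dividing it out;
  -- hence the exponent `2 |ε| T`.
  have h2 : Real.exp (-ε * (b - a)) ≤ Real.exp (|ε| * T) := by
    refine Real.exp_le_exp.2 ?_
    calc -ε * (b - a) ≤ |ε| * (b - a) :=
          mul_le_mul_of_nonneg_right (neg_le_abs _) (by linarith)
      _ ≤ |ε| * T := mul_le_mul_of_nonneg_left (by linarith) (abs_nonneg _)
  have h3 : V (x b) = Real.exp (-ε * (b - a)) * (Real.exp (ε * (b - a)) * V (x b)) := by
    rw [← mul_assoc, ← Real.exp_add]; simp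
  calc V (x b) = Real.exp (-ε * (b - a)) * (Real.exp (ε * (b - a)) * V (x b)) := h3
    _ ≤ Real.exp (-ε * (b - a)) * (V (x a) + Real.exp (|ε| * T) * T * αw ω) :=
        mul_le_mul_of_nonneg_left h1 (Real.exp_pos _).le
    _ = Real.exp (-ε * (b - a)) * V (x a) +
        Real.exp (-ε * (b - a)) * (Real.exp (|ε| * T) * T * αw ω) := by ring
    _ ≤ Real.exp (-ε * (b - a)) * V (x a) +
        Real.exp (|ε| * T) * (Real.exp (|ε| * T) * T * αw ω) := by gcongr
    _ = _ := by
        rw [show 2 * |ε| * T = |ε| * T + |ε| * T by ring, Real.exp_add]; ring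

end FlowEstimate
-- Hybrid time domains and the components of solutions
section Trajectories

theorem _root_.AbsolutelyContinuousOnInterval.prod_fst {E F : Type*} [SeminormedAddCommGroup E]
    [SeminormedAddCommGroup F] {u : ℝ → E × F} {a b : ℝ}
    (h : AbsolutelyContinuousOnInterval u a b) :
    AbsolutelyContinuousOnInterval (fun s => (u s).1) a b :=
  LipschitzWith.prod_fst.comp_absolutelyContinuousOnInterval h

theorem _root_.AbsolutelyContinuousOnInterval.prod_snd {E F : Type*} [SeminormedAddCommGroup E]
    [SeminormedAddCommGroup F] {u : ℝ → E × F} {a b : ℝ}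
    (h : AbsolutelyContinuousOnInterval u a b) :
    AbsolutelyContinuousOnInterval (fun s => (u s).2) a b :=
  LipschitzWith.prod_snd.comp_absolutelyContinuousOnInterval h

theorem _root_.HasDerivAt.prod_fst {E F : Type*} [NormedAddCommGroup E] [NormedSpace ℝ E]
    [NormedAddCommGroup F] [NormedSpace ℝ F] {u : ℝ → E × F} {u' : E × F} {t : ℝ}
    (h : HasDerivAt u u' t) : HasDerivAt (fun s => (u s).1) u'.1 t :=
  (ContinuousLinearMap.fst ℝ E F).hasFDerivAt.comp_hasDerivAt t h

theorem _root_.HasDerivAt.prod_snd {E F : Type*} [NormedAddCommGroup E] [NormedSpace ℝ E]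
    [NormedAddCommGroup F] [NormedSpace ℝ F] {u : ℝ → E × F} {u' : E × F} {t : ℝ}
    (h : HasDerivAt u u' t) : HasDerivAt (fun s => (u s).2) u'.2 t :=
  (ContinuousLinearMap.snd ℝ E F).hasFDerivAt.comp_hasDerivAt t h

/-- For `i < j`, `s (i + 1)` is the time of the jump from `i` to `i + 1`; the last interval is cut
off at `t`. -/
theorem IsHybridTimeDomain.exists_jump_times {D : Set (ℝ × ℕ)} (hD : IsHybridTimeDomain D)
    {t : ℝ} {j : ℕ} (h : (t, j) ∈ D) :
    ∃ s : ℕ → ℝ, s 0 = 0 ∧ s (j + 1) = t ∧ (∀ i ≤ j, s i ≤ s (i + 1)) ∧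
      ∀ i ≤ j, ∀ u, ((u, i) ∈ D ∧ u ≤ t) ↔ u ∈ Icc (s i) (s (i + 1)) := by
  obtain ⟨J, s, h0, hs, hEq⟩ := hD.2 _ h
  have hiff : ∀ i ≤ j, ∀ u, ((u, i) ∈ D ∧ u ≤ t) ↔ (i < J ∧ u ∈ Icc (s i) (s (i + 1))) := by
    intro i hi u
    have h1 : (u, i) ∈ D ∩ (Icc 0 t ×ˢ Iic j) ↔ (i < J ∧ u ∈ Icc (s i) (s (i + 1))) := by
      rw [hEq]
      simp only [mem_iUnion, mem_prod, Finset.mem_range, mem_singleton_iff]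
      constructor
      · rintro ⟨k, hk, hu, rfl⟩; exact ⟨hk, hu⟩
      · rintro ⟨hk, hu⟩; exact ⟨i, hk, hu, rfl⟩
    rw [← h1]
    constructor
    · rintro ⟨hu, hut⟩; exact ⟨hu, ⟨hD.1 _ hu, hut⟩, hi⟩
    · rintro ⟨hu, hut⟩; exact ⟨hu, hut.1.2⟩
  obtain ⟨hjJ, htj⟩ := (hiff j le_rfl t).1 ⟨h, le_rfl⟩
  refine ⟨s, h0, le_antisymm ?_ htj.2, fun i hi => hs i (by omega), fun i hi u => ?_⟩
  · exact ((hiff j le_rfl (s (j + 1))).2 ⟨hjJ, hs j hjJ, le_rfl⟩).2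
  · rw [hiff i hi u]
    exact ⟨fun h => h.2, fun h => ⟨by omega, h⟩⟩

theorem IsHybridTimeDomain.mem_of_mem_Icc {D : Set (ℝ × ℕ)} (hD : IsHybridTimeDomain D)
    {a b u : ℝ} {j : ℕ} (ha : (a, j) ∈ D) (hb : (b, j) ∈ D) (hu : u ∈ Icc a b) : (u, j) ∈ D := by
  obtain ⟨s, -, -, -, hs⟩ := hD.exists_jump_times hb
  have h1 := (hs j le_rfl a).1 ⟨ha, hu.1.trans hu.2⟩
  have h2 := (hs j le_rfl b).1 ⟨hb, le_rfl⟩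
  exact ((hs j le_rfl u).2 ⟨h1.1.trans hu.1, hu.2.trans h2.2⟩).1

theorem IsHybridTimeDomain.le_of_isSamplingInstant {D : Set (ℝ × ℕ)} (hD : IsHybridTimeDomain D)
    {t t' : ℝ} {j : ℕ} (h : IsSamplingInstant D j t) (h' : (t', j + 1) ∈ D) : t ≤ t' := by
  by_contra! hlt
  obtain ⟨s, -, -, -, hs⟩ := hD.exists_jump_times h.2
  have h1 := (hs j (by omega) t).1 ⟨h.1, le_rfl⟩
  have h2 := (hs (j + 1) le_rfl t').1 ⟨h', hlt.le⟩
  linarith [h1.2, h2.1]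

variable {X Win : Type*} [NormedAddCommGroup X] [NormedSpace ℝ X] {nη : ℕ}

/-- The behaviour of the components of a solution of the self-triggered closed loop on a time
interval without jumps. -/
structure FlowProperties (f : X → X → Win → X) (w : ℝ → Win) (ζ : ℝ → State X nη) (a b : ℝ) :
    Prop where
  absCont_x : AbsolutelyContinuousOnInterval (fun t => (ζ t).x) a b
  absCont_e : AbsolutelyContinuousOnInterval (fun t => (ζ t).e) a b
  hasDerivAt : ∀ᵐ t : ℝ, t ∈ Icc a b →
    HasDerivAt (fun t => (ζ t).x) (f (ζ t).x (ζ t).e (w t)) t ∧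
      HasDerivAt (fun t => (ζ t).e) (-f (ζ t).x (ζ t).e (w t)) t
  e_add_x : (ζ b).e + (ζ b).x = (ζ a).e + (ζ a).x
  η_eq : (ζ b).η = (ζ a).η
  τ_eq : (ζ b).τ = (ζ a).τ + (b - a)
  τmax_eq : (ζ b).τmax = (ζ a).τmax

section Components

variable {f : X → X → Win → X} {S : EuclideanSpace ℝ (Fin nη) → X → EuclideanSpace ℝ (Fin nη)}
  {Γ : X → EuclideanSpace ℝ (Fin nη) → ℝ} {w : ℝ → Win} {dom : Set (ℝ × ℕ)}
  {ξ : ℝ → ℕ → State X nη}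

theorem IsSolution.hasDerivAt_components (hsol : IsSolution (hybridSTC f S Γ) w dom ξ)
    {a b : ℝ} {j : ℕ} (ha : (a, j) ∈ dom) (hb : (b, j) ∈ dom) :
    ∀ᵐ t : ℝ, t ∈ Icc a b →
      HasDerivAt (fun t => (ξ t j).x) (f (ξ t j).x (ξ t j).e (w t)) t ∧
      HasDerivAt (fun t => (ξ t j).e) (-f (ξ t j).x (ξ t j).e (w t)) t ∧
      HasDerivAt (fun t => (ξ t j).η) 0 t ∧ HasDerivAt (fun t => (ξ t j).τ) 1 t ∧
      HasDerivAt (fun t => (ξ t j).τmax) 0 t := by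
  filter_upwards [hsol.flow j] with t ht htI
  have k1 : HasDerivAt (fun t => ξ t j) (f (ξ t j).x (ξ t j).e (w t),
    -f (ξ t j).x (ξ t j).e (w t), (0 : EuclideanSpace ℝ (Fin nη)), (1 : ℝ), (0 : ℝ)) t :=
    (ht (hsol.timeDomain.mem_of_mem_Icc ha hb htI)).2
  have k2 := k1.prod_snd
  have k3 := k2.prod_snd
  have k4 := k3.prod_snd
  exact ⟨k1.prod_fst, k2.prod_fst, k3.prod_fst, k4.prod_fst, k4.prod_snd⟩

theorem IsSolution.absCont_components (hsol : IsSolution (hybridSTC f S Γ) w dom ξ)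
    {a b : ℝ} {j : ℕ} (hab : a ≤ b) (ha : (a, j) ∈ dom) (hb : (b, j) ∈ dom) :
    AbsolutelyContinuousOnInterval (fun t => (ξ t j).x) a b ∧
      AbsolutelyContinuousOnInterval (fun t => (ξ t j).e) a b ∧
      AbsolutelyContinuousOnInterval (fun t => (ξ t j).η) a b ∧
      AbsolutelyContinuousOnInterval (fun t => (ξ t j).τ) a b ∧
      AbsolutelyContinuousOnInterval (fun t => (ξ t j).τmax) a b := by
  have k1 := hsol.absCont j a b hab ha hb
  have k2 := k1.prod_snd
  have k3 := k2.prod_snd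
  have k4 := k3.prod_snd
  exact ⟨k1.prod_fst, k2.prod_fst, k3.prod_fst, k4.prod_fst, k4.prod_snd⟩

theorem IsSolution.flowProperties (hsol : IsSolution (hybridSTC f S Γ) w dom ξ) {a b : ℝ} {j : ℕ}
    (hab : a ≤ b) (ha : (a, j) ∈ dom) (hb : (b, j) ∈ dom) :
    FlowProperties f w (fun t => ξ t j) a b := by
  obtain ⟨hx, he, hη, hτ, hτm⟩ := hsol.absCont_components hab ha hb
  have hd := hsol.hasDerivAt_components ha hb
  have huI : uIcc a b = Icc a b := uIcc_of_le hab
  have hal : a ∈ uIcc a b := left_mem_uIcc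
  have hbr : b ∈ uIcc a b := right_mem_uIcc
  refine ⟨hx, he, ?_, ?_, ?_, ?_, ?_⟩
  · filter_upwards [hd] with t ht htI
    exact ⟨(ht htI).1, (ht htI).2.1⟩
  -- The velocities of `e` and `x` are opposite, so their sum, the held sample, is constant.
  · obtain ⟨c, hc⟩ := (he.fun_add hx).const_of_ae_hasDerivAt_zero (by
      filter_upwards [hd] with t ht htI
      obtain ⟨k1, k2, -⟩ := ht (huI ▸ htI)
      simpa using! k2.add k1)
    exact (hc b hbr).trans (hc a hal).symm
  · obtain ⟨c, hc⟩ := hη.const_of_ae_hasDerivAt_zero (by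
      filter_upwards [hd] with t ht htI using (ht (huI ▸ htI)).2.2.1)
    exact (hc b hbr).trans (hc a hal).symm
  · have hid : AbsolutelyContinuousOnInterval (fun t : ℝ => t) a b :=
      ContDiffOn.absolutelyContinuousOnInterval contDiffOn_id
    obtain ⟨c, hc⟩ := (hτ.fun_sub hid).const_of_ae_hasDerivAt_zero (by
      filter_upwards [hd] with t ht htI
      simpa using! (ht (huI ▸ htI)).2.2.2.1.sub (hasDerivAt_id t))
    have := (hc b hbr).trans (hc a hal).symm
    linarith
  · obtain ⟨c, hc⟩ := hτm.const_of_ae_hasDerivAt_zero (by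
      filter_upwards [hd] with t ht htI using (ht (huI ▸ htI)).2.2.2.2)
    exact (hc b hbr).trans (hc a hal).symm

end Components

/-- A solution can flow only as long as the timer does not exceed the sampling interval. -/
theorem IsSolution.timer_le {f : X → X → Win → X}
    {S : EuclideanSpace ℝ (Fin nη) → X → EuclideanSpace ℝ (Fin nη)}
    {Γ : X → EuclideanSpace ℝ (Fin nη) → ℝ} {w : ℝ → Win} {dom : Set (ℝ × ℕ)}
    {ξ : ℝ → ℕ → State X nη} (hsol : IsSolution (hybridSTC f S Γ) w dom ξ) {a b : ℝ} {j : ℕ}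
    (ha : (a, j) ∈ dom) (hb : (b, j) ∈ dom) (h0 : (ξ a j).τ ≤ (ξ a j).τmax) :
    (ξ a j).τ + (b - a) ≤ (ξ a j).τmax := by
  by_contra! hlt
  -- The flow condition holds only almost everywhere, but a set of full measure is dense and meets
  -- the open interval where the timer has expired.
  obtain ⟨t, ⟨ht1, ht2⟩, ht⟩ := (Measure.dense_of_ae (hsol.flow j)).inter_open_nonempty
    (Ioo (a + ((ξ a j).τmax - (ξ a j).τ)) b) isOpen_Ioo (nonempty_Ioo.2 (by linarith))
  rw [mem_ofPred_eq] at ht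
  have hta : a ≤ t := by linarith
  have htd := hsol.timeDomain.mem_of_mem_Icc ha hb ⟨hta, ht2.le⟩
  have hF := hsol.flowProperties hta ha htd
  have h1 : (ξ t j).τ ≤ (ξ t j).τmax := (ht htd).1
  have h2 := hF.τ_eq
  have h3 := hF.τmax_eq
  linarith

end Trajectories

/-! ### The interval selection algorithm -/

section Interval

/-- The strict inequality matters later: a candidate that beats the nonnegative fallback cannot be
the default `0`. -/
theorem foldl_max_spec {ι : Type*} (c : ι → ℝ) (l : List ι) (h₀ : ℝ) :
    h₀ ≤ l.foldl (fun h i => if h < c i then c i else h) h₀ ∧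
      (l.foldl (fun h i => if h < c i then c i else h) h₀ = h₀ ∨
        ∃ i, l.foldl (fun h i => if h < c i then c i else h) h₀ = c i ∧ h₀ < c i) := by
  induction l generalizing h₀ with
  | nil => simp
  | cons i l ih =>
    simp only [List.foldl_cons]
    split_ifs with h
    · obtain ⟨h1, h2⟩ := ih (c i)
      refine ⟨h.le.trans h1, Or.inr ?_⟩
      rcases h2 with h2 | ⟨k, h2, h3⟩
      · exact ⟨i, h2, h⟩
      · exact ⟨k, h2, h.trans h3⟩
    · exact ih h₀

variable {N : ℕ}

theorem fallback_le_interval (δ εref : ℝ) (ε γ L : Fin (N + 1) → ℝ) (V C : ℝ) :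
    fallback δ ε γ L ≤ interval δ εref ε γ L V C :=
  (foldl_max_spec (fun i : Fin N =>
    candidate δ εref (ε i.succ) (γ i.succ) (L i.succ) V C) _ _).1

/-- The second argument of `T_max` for each of the parameter sets. -/
noncomputable def growthRate (δ : ℝ) (ε L : Fin (N + 1) → ℝ) : Fin (N + 1) → ℝ :=
  Fin.cons (L 0 + ε 0 / 2) fun i => max (L i.succ + ε i.succ / 2) (1 - δ)

theorem le_growthRate (δ : ℝ) (ε L : Fin (N + 1) → ℝ) (i : Fin (N + 1)) :
    L i + ε i / 2 ≤ growthRate δ ε L i := by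
  refine Fin.cases ?_ (fun i => ?_) i <;> simp [growthRate]

/-- Only `ε 0` is known to be positive; for the other sets `L i + ε i / 2` may be negative, and the
floor `1 - δ` takes over. -/
theorem growthRate_pos {δ : ℝ} {ε L : Fin (N + 1) → ℝ} (hδ : δ < 1) (hL : 0 < L 0)
    (hε : 0 < ε 0) (i : Fin (N + 1)) : 0 < growthRate δ ε L i := by
  refine Fin.cases ?_ (fun i => ?_) i
  · simp only [growthRate, Fin.cons_zero]; positivity
  · simp only [growthRate, Fin.cons_succ]
    exact lt_max_of_lt_right (by linarith)

/-- The sampling interval is admissible for one of the parameter sets, and for that set the decay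
over the sampling interval is at least that of the reference rate. -/
theorem interval_spec {δ εref : ℝ} {ε γ L : Fin (N + 1) → ℝ} {V C M : ℝ}
    (hfb : 0 ≤ fallback δ ε γ L) (hV : 0 ≤ V) (hVM : V ≤ M) (hCM : C ≤ M) :
    ∃ i, interval δ εref ε γ L V C ≤ δ * Tmax (γ i) (growthRate δ ε L i) ∧
      Real.exp (-ε i * interval δ εref ε γ L V C) * V ≤
        Real.exp (-min εref (ε 0) * interval δ εref ε γ L V C) * M := by
  have h0 : 0 ≤ interval δ εref ε γ L V C := hfb.trans (fallback_le_interval ..)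
  have hM : 0 ≤ M := hV.trans hVM
  rcases (foldl_max_spec (fun i : Fin N =>
    candidate δ εref (ε i.succ) (γ i.succ) (L i.succ) V C) (List.finRange N)
    (fallback δ ε γ L)).2 with h | ⟨i, h, hlt⟩
  · change interval δ εref ε γ L V C = _ at h
    refine ⟨0, by rw [h, fallback, growthRate, Fin.cons_zero], ?_⟩
    gcongr ?_ * ?_
    exact Real.exp_le_exp.2 (mul_le_mul_of_nonneg_right (neg_le_neg (min_le_right _ _)) h0)
  · change interval δ εref ε γ L V C = _ at h
    have hVC : V ≤ C := by
      by_contra hVC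
      simp only [candidate, if_neg hVC] at hlt
      linarith
    have hmin : Real.exp (-εref * interval δ εref ε γ L V C) * C ≤
        Real.exp (-min εref (ε 0) * interval δ εref ε γ L V C) * M := by
      have := hV.trans hVC
      gcongr ?_ * ?_
      exact Real.exp_le_exp.2 (mul_le_mul_of_nonneg_right (neg_le_neg (min_le_left _ _)) h0)
    refine ⟨i.succ, ?_, le_trans ?_ hmin⟩
    · rw [h, growthRate, Fin.cons_succ]
      simp only [candidate, if_pos hVC]
      split_ifs
      exacts [le_rfl, min_le_left _ _, le_rfl]
    · by_cases hlt' : 0 < -ε i.succ + εref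
      · by_cases hV0 : V = 0
        · rw [hV0, mul_zero]
          have := hV.trans hVC
          positivity
        · have hVp : 0 < V := lt_of_le_of_ne hV (Ne.symm hV0)
          have hCp : 0 < C := hVp.trans_le hVC
          have hle : interval δ εref ε γ L V C ≤
              (Real.log C - Real.log V) / (-ε i.succ + εref) := by
            rw [h]
            simp only [candidate, if_pos hVC, if_pos hlt', if_neg hV0]
            exact min_le_right _ _
          -- Cleared of the quotient, this is the logarithm of `exp (-ε_i h) V ≤ exp (-εref h) C`.
          rw [le_div_iff₀ hlt'] at hle
          rw [← Real.exp_log hCp, ← Real.exp_log hVp, ← Real.exp_add, ← Real.exp_add,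
            Real.exp_log hCp, Real.exp_log hVp]
          exact Real.exp_le_exp.2 (by linarith)
      · gcongr ?_ * ?_
        exact Real.exp_le_exp.2 (mul_le_mul_of_nonneg_right (by linarith) h0)

end Interval
-- Timing of the sampling instants
section Sampling

variable {X Win : Type*} [NormedAddCommGroup X] [NormedSpace ℝ X] {nη : ℕ}
  {f : X → X → Win → X} {S : EuclideanSpace ℝ (Fin nη) → X → EuclideanSpace ℝ (Fin nη)}
  {Γ : X → EuclideanSpace ℝ (Fin nη) → ℝ} {w : ℝ → Win} {dom : Set (ℝ × ℕ)}
  {ξ : ℝ → ℕ → State X nη}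

theorem IsSolution.sampling_le (hsol : IsSolution (hybridSTC f S Γ) w dom ξ)
    {t t' : ℝ} {j : ℕ} (ht : IsSamplingInstant dom j t) (ht' : (t', j + 1) ∈ dom)
    (hΓ : 0 ≤ Γ (ξ t j).x (ξ t j).η) : t' - t ≤ Γ (ξ t j).x (ξ t j).η := by
  have hj := (hsol.jump t j ht.1 ht.2).2
  have h0 : (ξ t (j + 1)).τ = 0 := by rw [hj]; rfl
  have hm : (ξ t (j + 1)).τmax = Γ (ξ t j).x (ξ t j).η := by rw [hj]; rfl
  have := hsol.timer_le ht.2 ht' (by rw [h0, hm]; exact hΓ)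
  rwa [h0, hm, zero_add] at this

theorem IsSolution.sampling_eq (hsol : IsSolution (hybridSTC f S Γ) w dom ξ)
    {t t' : ℝ} {j : ℕ} (ht : IsSamplingInstant dom j t) (ht' : IsSamplingInstant dom (j + 1) t') :
    t' - t = Γ (ξ t j).x (ξ t j).η := by
  have hle := hsol.timeDomain.le_of_isSamplingInstant ht ht'.1
  have hj := (hsol.jump t j ht.1 ht.2).2
  have hF := hsol.flowProperties hle ht.2 ht'.1
  have h1 : (ξ t' (j + 1)).τ = (ξ t' (j + 1)).τmax := (hsol.jump t' (j + 1) ht'.1 ht'.2).1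
  have h2 := hF.τ_eq
  have h3 := hF.τmax_eq
  have h0 : (ξ t (j + 1)).τ = 0 := by rw [hj]; rfl
  have hm : (ξ t (j + 1)).τmax = Γ (ξ t j).x (ξ t j).η := by rw [hj]; rfl
  linarith

/-- Initially the timer already equals `τmax`, which leaves no room for flow before the first jump.
-/
theorem IsSolution.eq_zero_of_admissibleInit (hsol : IsSolution (hybridSTC f S Γ) w dom ξ)
    (hinit : AdmissibleInit (ξ 0 0)) {t : ℝ} (ht : (t, 0) ∈ dom) : t = 0 := by
  obtain ⟨s, h0, h1, hs, hmem⟩ := hsol.timeDomain.exists_jump_times ht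
  have h00 : (0, 0) ∈ dom := ((hmem 0 le_rfl 0).2 ⟨h0.le, h0 ▸ hs 0 le_rfl⟩).1
  have := hsol.timer_le h00 ht hinit.2.ge
  have h2 := hinit.2
  have h3 := hsol.timeDomain.1 _ ht
  simp only at h3
  linarith

end Sampling

/-! ### The level of the state under the FIR mechanism -/

section Mechanism

variable {X : Type*} {N m : ℕ} {V : X → ℝ} {δ εref : ℝ} {ε γ L : Fin (N + 1) → ℝ}

/-- The maximum of `V(x)` and the moduli of the components of `η`. -/
noncomputable def level {nη : ℕ} (V : X → ℝ) (ζ : State X nη) : ℝ := max (V ζ.x) ‖ζ.η.ofLp‖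

theorem le_level {nη : ℕ} (V : X → ℝ) (ζ : State X nη) : V ζ.x ≤ level V ζ := le_max_left _ _

theorem abs_apply_le_level {nη : ℕ} (V : X → ℝ) (ζ : State X nη) (k : Fin nη) :
    |ζ.η k| ≤ level V ζ :=
  (norm_le_pi_norm ζ.η.ofLp k).trans (le_max_right _ _)

theorem level_nonneg {nη : ℕ} (V : X → ℝ) (ζ : State X nη) : 0 ≤ level V ζ :=
  (norm_nonneg _).trans (le_max_right _ _)

/-- An average of `m` numbers, `V x` and the `m - 1` entries of `η`, is at most any common upper
bound. -/
theorem firC_le_level (hm : 1 < m) (ζ : State X (m - 1)) : firC m V ζ.x ζ.η ≤ level V ζ := by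
  have hsum : ∑ k, ζ.η k ≤ ∑ _k : Fin (m - 1), level V ζ :=
    Finset.sum_le_sum fun k _ => (le_abs_self _).trans (abs_apply_le_level V ζ k)
  rw [Finset.sum_const, Finset.card_univ, Fintype.card_fin, nsmul_eq_mul,
    Nat.cast_sub hm.le, Nat.cast_one] at hsum
  have hm0 : (0 : ℝ) < m := by positivity
  rw [firC, one_div, inv_mul_le_iff₀ hm0]
  linarith [le_level V ζ]

/-- In the sup norm, a shift that drops one entry and appends `V x` cannot exceed the level, so only
the exponential factor remains. -/
theorem norm_firS_le (hV : ∀ x, 0 ≤ V x) (ζ : State X (m - 1)) :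
    ‖(firS m V δ εref ε γ L ζ.η ζ.x).ofLp‖ ≤
      Real.exp (-εref * firΓ m V δ εref ε γ L ζ.x ζ.η) * level V ζ := by
  refine (pi_norm_le_iff_of_nonneg (mul_nonneg (Real.exp_pos _).le (level_nonneg V ζ))).2
    fun k => ?_
  rw [firS, Real.norm_eq_abs, abs_mul, abs_of_pos (Real.exp_pos _)]
  refine mul_le_mul_of_nonneg_left ?_ (Real.exp_pos _).le
  split_ifs with h
  · exact abs_apply_le_level V ζ _
  · rw [abs_of_nonneg (hV _)]; exact le_level V ζ

theorem fallback_le_firΓ (x : X) (η : EuclideanSpace ℝ (Fin (m - 1))) :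
    fallback δ ε γ L ≤ firΓ m V δ εref ε γ L x η := fallback_le_interval ..

end Mechanism

section Positivity

variable {X Win : Type*} [NormedAddCommGroup X] [InnerProductSpace ℝ X] [CompleteSpace X]
  [MeasureSpace X] [NormedAddCommGroup Win] {N : ℕ} {f : X → X → Win → X} {V : X → ℝ}
  {αw : ℝ≥0 → ℝ≥0} {ε γ L : Fin (N + 1) → ℝ} {δ : ℝ}

theorem HybridLyapunovAssumption.nonneg {ε γ L : ℝ} (h : HybridLyapunovAssumption f V αw ε γ L)
    (x : X) : 0 ≤ V x := by
  obtain ⟨-, -, -, -, W, H, αWlo, αWup, αVlo, αVup, -, -, -, -, -, -, -, -, hVb, -⟩ := h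
  exact (NNReal.coe_nonneg _).trans (hVb x).1

theorem fallback_pos (hA : ∀ i, HybridLyapunovAssumption f V αw (ε i) (γ i) (L i)) (hε : 0 < ε 0)
    (hδ : 0 < δ) : 0 < fallback δ ε γ L := by
  obtain ⟨hL, hγ, -⟩ := hA 0
  exact mul_pos hδ (Tmax_pos hγ (by positivity))

end Positivity

/-! ### Decay of the level along solutions -/

section Decay

variable {X Win : Type*} [NormedAddCommGroup X] [InnerProductSpace ℝ X] [FiniteDimensional ℝ X]
  [MeasureSpace X] [BorelSpace X] [(volume : Measure X).IsAddHaarMeasure]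
  [NormedAddCommGroup Win] {N m : ℕ} {f : X → X → Win → X} {V : X → ℝ} {αw : ℝ≥0 → ℝ≥0}
  {ε γ L : Fin (N + 1) → ℝ} {δ εref : ℝ}

/-- Uniform bounds on `V` between two sampling instants, and at the second one. -/
theorem exists_intersample_bound (hf : Continuous fun p : X × X × Win => f p.1 p.2.1 p.2.2)
    (hA : ∀ i, HybridLyapunovAssumption f V αw (ε i) (γ i) (L i)) (hε : 0 < ε 0)
    (hδ : δ ∈ Ioo (0 : ℝ) 1) :
    ∃ T D K : ℝ, 0 ≤ T ∧ 0 ≤ D ∧ 1 ≤ K ∧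
      (∀ v C, 0 ≤ v → interval δ εref ε γ L v C ≤ T) ∧
      ∀ {nη : ℕ} {ζ : ℝ → State X nη} {w : ℝ → Win} {ω : ℝ≥0} {a b C M : ℝ}, a ≤ b →
        FlowProperties f w ζ a b → (∀ᵐ t : ℝ, t ∈ Icc a b → ‖w t‖₊ ≤ ω) → (ζ a).e = 0 →
        V (ζ a).x ≤ M → C ≤ M → b - a ≤ interval δ εref ε γ L (V (ζ a).x) C →
        V (ζ b).x ≤ K * M + D * αw ω ∧
          (b - a = interval δ εref ε γ L (V (ζ a).x) C →
            V (ζ b).x ≤ Real.exp (-min εref (ε 0) * (b - a)) * M + D * αw ω) := by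
  have hfb : 0 < fallback δ ε γ L := fallback_pos hA hε hδ.1
  have hΛ : ∀ i, 0 < growthRate δ ε L i := growthRate_pos hδ.2 (hA 0).1 hε
  have hTi : ∀ i, 0 < Tmax (γ i) (growthRate δ ε L i) := fun i => Tmax_pos (hA i).2.1 (hΛ i)
  -- Sums over the finitely many parameter sets serve as common bounds for all of them.
  set T := ∑ i, Tmax (γ i) (growthRate δ ε L i) with hT
  set B := ∑ i, |ε i| with hB
  have hTle : ∀ i, Tmax (γ i) (growthRate δ ε L i) ≤ T := fun i =>
    Finset.single_le_sum (f := fun i => Tmax (γ i) (growthRate δ ε L i))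
      (fun k _ => (hTi k).le) (Finset.mem_univ i)
  have hBle : ∀ i, |ε i| ≤ B := fun i =>
    Finset.single_le_sum (f := fun i => |ε i|) (fun k _ => abs_nonneg _) (Finset.mem_univ i)
  have hT0 : 0 ≤ T := (hTi 0).le.trans (hTle 0)
  have hB0 : 0 ≤ B := (abs_nonneg _).trans (hBle 0)
  have hδT : ∀ i, δ * Tmax (γ i) (growthRate δ ε L i) ≤ T := fun i =>
    (mul_le_of_le_one_left (hTi i).le hδ.2.le).trans (hTle i)
  refine ⟨T, Real.exp (2 * B * T) * T, Real.exp (B * T), hT0, by positivity,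
    Real.one_le_exp (by positivity), fun v C hv => ?_, ?_⟩
  · obtain ⟨i, hi, -⟩ := interval_spec (εref := εref) hfb.le hv (le_max_left v C) (le_max_right v C)
    exact hi.trans (hδT i)
  · intro nη ζ w ω a b C M hab hF hw he hVM hCM hb
    have hV0 := (hA 0).nonneg (ζ a).x
    have hM : 0 ≤ M := hV0.trans hVM
    obtain ⟨i, hi, hdec⟩ := interval_spec (εref := εref) hfb.le hV0 hVM hCM
    have hest := lyapunov_flow_estimate hf (hA i) (hΛ i) (le_growthRate δ ε L i) hδ.2 hab
      (hb.trans hi) hF.absCont_x hF.absCont_e hF.hasDerivAt hw he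
    have hD : Real.exp (2 * |ε i| * Tmax (γ i) (growthRate δ ε L i)) *
        Tmax (γ i) (growthRate δ ε L i) * αw ω ≤ Real.exp (2 * B * T) * T * αw ω := by
      have h1 := hTle i
      have h2 := hBle i
      have h3 := (hTi i).le
      gcongr
    -- The active `ε i` may be negative, so `V` may grow inside the interval; the comparison with
    -- the reference rate is made only at its end.
    refine ⟨?_, fun heq => ?_⟩
    · have h1 : Real.exp (-ε i * (b - a)) * V (ζ a).x ≤ Real.exp (B * T) * M := by
        refine mul_le_mul (Real.exp_le_exp.2 ?_) hVM hV0 (Real.exp_pos _).le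
        calc -ε i * (b - a) ≤ |ε i| * (b - a) :=
              mul_le_mul_of_nonneg_right (neg_le_abs _) (by linarith)
          _ ≤ B * T := mul_le_mul (hBle i) ((hb.trans hi).trans (hδT i)) (by linarith) hB0
      linarith
    · rw [← heq] at hdec
      linarith

/-- Exponential decay, up to the effect of the disturbance, of the quantities that determine the
state after the first sampling instant. -/
theorem exists_decay_bound (hf : Continuous fun p : X × X × Win => f p.1 p.2.1 p.2.2) (hm : 1 < m)
    (hA : ∀ i, HybridLyapunovAssumption f V αw (ε i) (γ i) (L i)) (hε : 0 < ε 0)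
    (hδ : δ ∈ Ioo (0 : ℝ) 1) (hεref : 0 < εref) :
    ∃ K D : ℝ, 0 < K ∧ 0 ≤ D ∧ ∀ {w : ℝ → Win} {dom : Set (ℝ × ℕ)}
      {ξ : ℝ → ℕ → State X (m - 1)} {ω : ℝ≥0},
      (∀ᵐ t : ℝ, 0 ≤ t → ‖w t‖₊ ≤ ω) →
      IsSolution (hybridSTC f (firS m V δ εref ε γ L) (firΓ m V δ εref ε γ L)) w dom ξ →
      AdmissibleInit (ξ 0 0) → ∀ {t : ℝ} {j : ℕ}, (t, j + 1) ∈ dom →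
      ∃ Q, Q = K * Real.exp (-min εref (ε 0) * t) * level V (ξ 0 0) + D * αw ω ∧
        V (ξ t (j + 1)).x ≤ Q ∧ ‖(ξ t (j + 1)).η.ofLp‖ ≤ Q ∧ j * fallback δ ε γ L ≤ t ∧
        ∃ y, V y ≤ Q ∧ (ξ t (j + 1)).e = y - (ξ t (j + 1)).x := by
  obtain ⟨T, D, K, hT, hD, hK, hΓT, hstep⟩ :=
    exists_intersample_bound (εref := εref) hf hA hε hδ
  have hh := fallback_pos hA hε hδ.1
  set h := fallback δ ε γ L
  set a := min εref (ε 0)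
  have ha : 0 < a := lt_min hεref hε
  have hV : ∀ x, 0 ≤ V x := (hA 0).nonneg
  have hρ : Real.exp (-a * h) < 1 := Real.exp_lt_one_iff.2 (by nlinarith)
  -- `D'` is the fixed point of `y ↦ exp (-a h) y + D`, the sum of the geometric series of
  -- disturbance contributions.
  set D' := D / (1 - Real.exp (-a * h)) with hD'def
  have hD' : 0 ≤ D' := div_nonneg hD (by linarith)
  have hD'eq : Real.exp (-a * h) * D' + D = D' := by
    have := div_mul_cancel₀ D (by linarith : (1 - Real.exp (-a * h)) ≠ 0)
    rw [← hD'def] at this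
    linarith
  -- `K` bounds the growth since the last sampling, and `exp (a T)` pays for replacing its time by
  -- the current time, at most `T` later.
  refine ⟨K * Real.exp (a * T), K * D' + D, by positivity, by positivity, ?_⟩
  intro w dom ξ ω hw hsol hinit t j htj
  set Γ := firΓ m V δ εref ε γ L
  set d : ℝ := ((αw ω : ℝ≥0) : ℝ)
  have hd : 0 ≤ d := NNReal.coe_nonneg _
  have hΓ : ∀ x η, 0 ≤ Γ x η := fun x η => hh.le.trans (fallback_le_firΓ x η)
  have hsamp : ∀ {r r' : ℝ} {i : ℕ}, IsSamplingInstant dom i r → (r', i + 1) ∈ dom →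
      V (ξ r' (i + 1)).x ≤ K * level V (ξ r i) + D * d ∧
      ‖(ξ r' (i + 1)).η.ofLp‖ ≤ Real.exp (-a * (r' - r)) * level V (ξ r i) ∧
      (ξ r' (i + 1)).e = (ξ r i).x - (ξ r' (i + 1)).x ∧
      (r' - r = Γ (ξ r i).x (ξ r i).η →
        V (ξ r' (i + 1)).x ≤ Real.exp (-a * (r' - r)) * level V (ξ r i) + D * d) := by
    intro r r' i hr hr'
    have hrr := hsol.timeDomain.le_of_isSamplingInstant hr hr'
    have hr0 : 0 ≤ r := hsol.timeDomain.1 _ hr.1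
    have hle := hsol.sampling_le hr hr' (hΓ _ _)
    have hF := hsol.flowProperties hrr hr.2 hr'
    have hj := (hsol.jump r i hr.1 hr.2).2
    have hx : (ξ r (i + 1)).x = (ξ r i).x := by rw [hj]; rfl
    have he : (ξ r (i + 1)).e = 0 := by rw [hj]; rfl
    have hη : (ξ r (i + 1)).η = firS m V δ εref ε γ L (ξ r i).η (ξ r i).x := by rw [hj]; rfl
    have hst := hstep hrr hF (by filter_upwards [hw] with u hu huI using hu (hr0.trans huI.1)) he
      (M := level V (ξ r i)) (C := firC m V (ξ r i).x (ξ r i).η)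
      (by simp only [hx]; exact le_level V _) (firC_le_level hm _) (by simp only [hx]; exact hle)
    simp only [hx] at hst
    refine ⟨hst.1, ?_, ?_, hst.2⟩
    · have h1 := hF.η_eq
      rw [h1, hη]
      refine (norm_firS_le hV _).trans ?_
      refine mul_le_mul_of_nonneg_right (Real.exp_le_exp.2 ?_) (level_nonneg _ _)
      have h2 : a * (r' - r) ≤ εref * Γ (ξ r i).x (ξ r i).η :=
        mul_le_mul (min_le_left _ _) hle (by linarith) hεref.le
      simp only [Γ] at h2
      linarith
    · have h1 := hF.e_add_x
      simp only [he, hx, zero_add] at h1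
      exact eq_sub_of_add_eq h1
  obtain ⟨s, hs0, hst, hmono, hmem⟩ := hsol.timeDomain.exists_jump_times htj
  have hinst : ∀ i ≤ j, IsSamplingInstant dom i (s (i + 1)) := fun i hi =>
    ⟨((hmem i (by omega) _).2 ⟨hmono i (by omega), le_rfl⟩).1,
      ((hmem (i + 1) (by omega) _).2 ⟨le_rfl, hmono (i + 1) (by omega)⟩).1⟩
  -- The jump out of index `i` occurs at `s (i + 1)`. The first one is at time `0`, so only `i` full
  -- intervals have elapsed by then.
  have hdecay : ∀ i ≤ j, i * h ≤ s (i + 1) ∧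
      level V (ξ (s (i + 1)) i) ≤ Real.exp (-a * s (i + 1)) * level V (ξ 0 0) + D' * d := by
    intro i
    induction i with
    | zero =>
      intro _
      have h1 := hsol.eq_zero_of_admissibleInit hinit (hinst 0 (by omega)).1
      rw [h1]
      simp only [Nat.cast_zero, zero_mul, le_refl, mul_zero, Real.exp_zero, one_mul, true_and]
      have : 0 ≤ D' * d := by positivity
      linarith
    | succ i ih =>
      intro hi
      obtain ⟨ih1, ih2⟩ := ih (by omega)
      have hi1 := hinst i (by omega)
      have hi2 := hinst (i + 1) hi
      have heq := hsol.sampling_eq hi1 hi2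
      have hge : h ≤ s (i + 1 + 1) - s (i + 1) := by rw [heq]; exact fallback_le_firΓ _ _
      obtain ⟨-, k2, -, k4⟩ := hsamp hi1 hi2.1
      have k4 := k4 heq
      refine ⟨by push_cast; linarith, ?_⟩
      have hlev : level V (ξ (s (i + 1 + 1)) (i + 1)) ≤
          Real.exp (-a * (s (i + 1 + 1) - s (i + 1))) * level V (ξ (s (i + 1)) i) + D * d :=
        max_le k4 (k2.trans (le_add_of_nonneg_right (by positivity)))
      refine hlev.trans ?_
      have hE : Real.exp (-a * (s (i + 1 + 1) - s (i + 1))) ≤ Real.exp (-a * h) :=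
        Real.exp_le_exp.2 (by nlinarith)
      calc _ ≤ Real.exp (-a * (s (i + 1 + 1) - s (i + 1))) *
            (Real.exp (-a * s (i + 1)) * level V (ξ 0 0) + D' * d) + D * d := by gcongr
        _ = Real.exp (-a * s (i + 1 + 1)) * level V (ξ 0 0) +
            (Real.exp (-a * (s (i + 1 + 1) - s (i + 1))) * D' + D) * d := by
            rw [mul_add, ← mul_assoc, ← Real.exp_add]; ring_nf
        _ ≤ Real.exp (-a * s (i + 1 + 1)) * level V (ξ 0 0) +
            (Real.exp (-a * h) * D' + D) * d := by gcongr
        _ = _ := by rw [hD'eq]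
  obtain ⟨h1, h2⟩ := hdecay j le_rfl
  have hj := hinst j le_rfl
  have hle : s (j + 1) ≤ t := hsol.timeDomain.le_of_isSamplingInstant hj htj
  have hTle : t - s (j + 1) ≤ T := (hsol.sampling_le hj htj (hΓ _ _)).trans (hΓT _ _ (hV _))
  obtain ⟨k1, k2, k3, -⟩ := hsamp hj htj
  have hlev : level V (ξ (s (j + 1)) j) ≤
      Real.exp (a * T) * Real.exp (-a * t) * level V (ξ 0 0) + D' * d := by
    refine h2.trans ?_
    have := level_nonneg V (ξ 0 0)
    rw [← Real.exp_add]
    gcongr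
    nlinarith
  have hA0 := level_nonneg V (ξ 0 0)
  have hpos : 0 ≤ Real.exp (a * T) * Real.exp (-a * t) * level V (ξ 0 0) + D' * d := by positivity
  have hKlev : K * level V (ξ (s (j + 1)) j) + D * d ≤
      K * Real.exp (a * T) * Real.exp (-a * t) * level V (ξ 0 0) + (K * D' + D) * d := by
    have := mul_le_mul_of_nonneg_left hlev (by linarith : 0 ≤ K)
    linarith
  have hlevQ : level V (ξ (s (j + 1)) j) ≤
      K * Real.exp (a * T) * Real.exp (-a * t) * level V (ξ 0 0) + (K * D' + D) * d := by
    have h3 := le_mul_of_one_le_left (level_nonneg V (ξ (s (j + 1)) j)) hK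
    have h4 : 0 ≤ D * d := by positivity
    linarith
  refine ⟨_, rfl, k1.trans hKlev, ?_, h1.trans hle, (ξ (s (j + 1)) j).x,
    (le_level V _).trans hlevQ, k3⟩
  refine k2.trans (le_trans ?_ hlevQ)
  refine mul_le_of_le_one_left (level_nonneg _ _) (Real.exp_le_one_iff.2 ?_)
  nlinarith

end Decay
-- Comparison functions
section Comparison

/-- By the intermediate value theorem `α` is onto, hence an order isomorphism, and the inverse of an
order isomorphism is continuous. -/
theorem IsClassKInf.exists_isClassK_leftInverse {α : ℝ≥0 → ℝ≥0} (h : IsClassKInf α) :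
    ∃ σ : ℝ≥0 → ℝ≥0, IsClassK σ ∧ Function.LeftInverse σ α := by
  have hsurj : Function.Surjective α := by
    intro y
    obtain ⟨_, ⟨b, rfl⟩, hb⟩ := not_bddAbove_iff.1 h.unbounded y
    exact mem_range_of_exists_le_of_exists_ge h.continuous ⟨0, by simp [h.map_zero]⟩ ⟨b, hb.le⟩
  let o := StrictMono.orderIsoOfSurjective α h.strictMono hsurj
  have ho : ∀ s, o.symm (α s) = s := fun s => o.symm_apply_apply s
  exact ⟨o.symm, ⟨o.symm.continuous, o.symm.strictMono, by simpa [h.map_zero] using ho 0⟩, ho⟩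

/-- The summand `q * g t` is for the state before the first jump, where `e` is arbitrary; the second
one covers all later times. -/
theorem isClassKL_of_decay {α κ g : ℝ≥0 → ℝ≥0} (hα : IsClassK α) (hκ : IsClassK κ)
    (hgc : Continuous g) (hg0 : ∀ t, 0 < g t) (hga : Antitone g) (hgt : Tendsto g atTop (𝓝 0)) :
    IsClassKL fun q t => q * g t + α (κ q * g t) where
  continuous := by
    have := hα.continuous
    have := hκ.continuous
    fun_prop
  classK t := by
    refine ⟨?_, fun p q hpq => ?_, by simp [hα.map_zero, hκ.map_zero]⟩
    · have := hα.continuous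
      have := hκ.continuous
      fun_prop
    · exact add_lt_add (mul_lt_mul_of_pos_right hpq (hg0 t))
        (hα.strictMono (mul_lt_mul_of_pos_right (hκ.strictMono hpq) (hg0 t)))
  antitone q s t hst := by
    have := hga hst
    exact add_le_add (mul_le_mul_right this _) (hα.strictMono.monotone (mul_le_mul_right this _))
  tendsto_zero q := by
    have h1 : Tendsto (fun t => κ q * g t) atTop (𝓝 0) := by simpa using hgt.const_mul (κ q)
    have h2 := (hα.continuous.tendsto 0).comp h1
    rw [hα.map_zero] at h2
    simpa using (hgt.const_mul q).add h2

/-- The function `s ↦ exp (-c s)` on the nonnegative reals. -/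
noncomputable def expDecay (c : ℝ) (s : ℝ≥0) : ℝ≥0 := (Real.exp (-(c * s))).toNNReal

theorem coe_expDecay (c : ℝ) (s : ℝ≥0) : (expDecay c s : ℝ) = Real.exp (-(c * s)) :=
  Real.coe_toNNReal _ (Real.exp_pos _).le

theorem expDecay_pos (c : ℝ) (s : ℝ≥0) : 0 < expDecay c s :=
  Real.toNNReal_pos.2 (Real.exp_pos _)

theorem continuous_expDecay (c : ℝ) : Continuous (expDecay c) := by
  unfold expDecay; fun_prop

theorem antitone_expDecay {c : ℝ} (hc : 0 ≤ c) : Antitone (expDecay c) := by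
  intro s t hst
  refine Real.toNNReal_le_toNNReal (Real.exp_le_exp.2 (neg_le_neg ?_))
  exact mul_le_mul_of_nonneg_left (NNReal.coe_le_coe.2 hst) hc

theorem tendsto_expDecay {c : ℝ} (hc : 0 < c) : Tendsto (expDecay c) atTop (𝓝 0) := by
  have h1 : Tendsto (fun s : ℝ≥0 => c * (s : ℝ)) atTop atTop :=
    (NNReal.tendsto_coe_atTop.2 tendsto_id).const_mul_atTop hc
  have h2 := (continuous_real_toNNReal.tendsto 0).comp (Real.tendsto_exp_neg_atTop_nhds_zero.comp h1)
  rw [Real.toNNReal_zero] at h2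
  exact h2

theorem isClassKLL_of_expDecay {α κ : ℝ≥0 → ℝ≥0} (hα : IsClassK α) (hκ : IsClassK κ) {c : ℝ}
    (hc : 0 < c) :
    IsClassKLL fun q t r => q * expDecay c (t + r) + α (κ q * expDecay c (t + r)) := by
  have hcont := continuous_expDecay c
  have hanti := antitone_expDecay hc.le
  have htend := tendsto_expDecay hc
  constructor
  · intro r
    exact isClassKL_of_decay hα hκ (g := fun t => expDecay c (r + t)) (by fun_prop)
      (fun t => expDecay_pos _ _) (fun s t hst => hanti (by gcongr))
      (htend.comp (tendsto_atTop_mono (fun _ => le_add_self) tendsto_id))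
  · intro r
    exact isClassKL_of_decay hα hκ (g := fun t => expDecay c (t + r)) (by fun_prop)
      (fun t => expDecay_pos _ _) (fun s t hst => hanti (by gcongr))
      (htend.comp (tendsto_atTop_mono (fun _ => le_self_add) tendsto_id))

end Comparison

section StackNorm

variable {X : Type*} [NormedAddCommGroup X] {nη : ℕ}

theorem nnnorm_x_le_stackNorm (ζ : State X nη) : ‖ζ.x‖₊ ≤ ζ.stackNorm := by
  rw [State.stackNorm, NNReal.le_sqrt_iff_sq_le, add_assoc]
  exact le_self_add

theorem nnnorm_η_le_stackNorm (ζ : State X nη) : ‖ζ.η‖₊ ≤ ζ.stackNorm := by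
  rw [State.stackNorm, NNReal.le_sqrt_iff_sq_le]
  exact le_add_self

theorem stackNorm_le_add (ζ : State X nη) : ζ.stackNorm ≤ ‖ζ.x‖₊ + ‖ζ.e‖₊ + ‖ζ.η‖₊ := by
  rw [State.stackNorm, NNReal.sqrt_le_iff_le_sq]
  have : (‖ζ.x‖₊ + ‖ζ.e‖₊ + ‖ζ.η‖₊) ^ 2 = ‖ζ.x‖₊ ^ 2 + ‖ζ.e‖₊ ^ 2 + ‖ζ.η‖₊ ^ 2 +
      2 * (‖ζ.x‖₊ * ‖ζ.e‖₊ + ‖ζ.x‖₊ * ‖ζ.η‖₊ + ‖ζ.e‖₊ * ‖ζ.η‖₊) := by ring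
  rw [this]
  exact le_self_add

end StackNorm

theorem ae_nnnorm_le_inputNorm {Win : Type*} [NormedAddCommGroup Win] {w : ℝ → Win}
    (hw : inputNorm w ≠ ∞) : ∀ᵐ t : ℝ, 0 ≤ t → ‖w t‖₊ ≤ (inputNorm w).toNNReal := by
  have h := enorm_ae_le_eLpNormEssSup w (volume.restrict (Ici (0 : ℝ)))
  rw [ae_restrict_iff' measurableSet_Ici] at h
  filter_upwards [h] with t ht h0
  have h1 : ‖w t‖ₑ ≤ inputNorm w := by
    rw [inputNorm, eLpNorm_exponent_top]; exact ht h0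
  rw [← ENNReal.coe_le_coe, ENNReal.coe_toNNReal hw]
  exact h1

/-! ### From exponential decay of the level to ISS -/

section Stability

variable {X Win : Type*} [NormedAddCommGroup X] [InnerProductSpace ℝ X] [FiniteDimensional ℝ X]
  [MeasureSpace X] [BorelSpace X] [(volume : Measure X).IsAddHaarMeasure]
  [NormedAddCommGroup Win] {N m : ℕ} {f : X → X → Win → X} {V : X → ℝ} {αw : ℝ≥0 → ℝ≥0}
  {ε γ L : Fin (N + 1) → ℝ} {δ εref : ℝ}

theorem isISS_hybridSTC (hf : Continuous fun p : X × X × Win => f p.1 p.2.1 p.2.2) (hm : 1 < m)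
    (hA : ∀ i, HybridLyapunovAssumption f V αw (ε i) (γ i) (L i)) (hε : 0 < ε 0)
    (hδ : δ ∈ Ioo (0 : ℝ) 1) (hεref : 0 < εref) :
    IsISS (hybridSTC f (firS m V δ εref ε γ L) (firΓ m V δ εref ε γ L)) := by
  obtain ⟨K, D, hK, hD, hbound⟩ := exists_decay_bound hf hm hA hε hδ hεref
  have hh := fallback_pos hA hε hδ.1
  obtain ⟨-, -, -, hαw, W, H, αWlo, αWup, αVlo, αVup, -, -, -, -, -, hVlo, hVup, -, hVb, -⟩ := hA 0
  obtain ⟨σ, hσ, hσinv⟩ := hVlo.exists_isClassK_leftInverse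
  set h := fallback δ ε γ L
  set a := min εref (ε 0)
  have ha : 0 < a := lt_min hεref hε
  lift K to ℝ≥0 using hK.le
  lift D to ℝ≥0 using hD
  have hK : 0 < K := hK
  -- `c₀` compares the Euclidean norm of `η` with the sup norm used in `level`.
  obtain ⟨c₀, hc₀⟩ : ∃ c₀ : ℝ≥0, ∀ η : EuclideanSpace ℝ (Fin (m - 1)),
      ‖η‖₊ ≤ c₀ * ‖η.ofLp‖₊ := by
    have h := PiLp.antilipschitzWith_ofLp 2 fun _ : Fin (m - 1) => ℝ
    exact ⟨_, fun η => by simpa [nndist_zero_right] using h.le_mul_nndist η 0⟩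
  -- The coefficient `3` counts one state norm for `x` and two for `e`. Doubling the argument
  -- permits the splitting `σ (s + t) ≤ σ (2 s) + σ (2 t)`.
  set α : ℝ≥0 → ℝ≥0 := fun s => 3 * σ (2 * s) + c₀ * (2 * s) with hα
  have hαK : IsClassK α := by
    refine ⟨?_, fun s t hst => ?_, by simp [hα, hσ.map_zero]⟩
    · have := hσ.continuous
      fun_prop
    · have h1 : 2 * s < 2 * t := by gcongr
      exact add_lt_add_of_lt_of_le (mul_lt_mul_of_pos_left (hσ.strictMono h1) (by norm_num))
        (mul_le_mul_right h1.le _)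
  have hαadd : ∀ s t, 3 * σ (s + t) + c₀ * (s + t) ≤ α s + α t := by
    intro s t
    wlog hst : s ≤ t generalizing s t
    · rw [add_comm s t, add_comm (α s)]
      exact this t s (le_of_not_ge hst)
    have h1 : s + t ≤ 2 * t := by rw [two_mul]; gcongr
    calc 3 * σ (s + t) + c₀ * (s + t) ≤ α t := by
          simp only [hα]
          have := hσ.strictMono.monotone h1
          gcongr
      _ ≤ α s + α t := le_add_self
  -- Half of the exponent `a t` is kept for time; the other half is converted into decay in the
  -- jumps through `j h ≤ t`.
  set c := min (a / 2) (a * h / 2) with hc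
  have hcpos : 0 < c := lt_min (by positivity) (by positivity)
  -- The factor `exp (a h / 2)` accounts for the index being `j + 1` while only `j h ≤ t` is
  -- available.
  set K' : ℝ≥0 := K * (Real.exp (a * h / 2)).toNNReal with hK'
  have hK'pos : 0 < K' := mul_pos hK (Real.toNNReal_pos.2 (Real.exp_pos _))
  have hκ : IsClassK fun q => K' * (αVup q + q) := by
    refine ⟨?_, fun p q hpq => ?_, by simp [hVup.map_zero]⟩
    · have := hVup.continuous
      fun_prop
    · exact mul_lt_mul_of_pos_left (add_lt_add (hVup.strictMono hpq) hpq) hK'pos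
  -- The added `s` keeps the gain strictly increasing and unbounded even if `D = 0`.
  have hψ : IsClassKInf fun s => α (D * αw s) + s := by
    refine ⟨⟨?_, fun s t hst => ?_, by simp [hαw.map_zero, hαK.map_zero]⟩, ?_⟩
    · have := hαK.continuous
      have := hαw.continuous
      fun_prop
    · refine add_lt_add_of_le_of_lt (hαK.strictMono.monotone ?_) hst
      exact mul_le_mul_right (hαw.strictMono.monotone hst.le) _
    · rintro ⟨b, hb⟩
      have h1 : α (D * αw (b + 1)) + (b + 1) ≤ b := hb ⟨b + 1, rfl⟩
      have h2 : b + 1 ≤ b := le_add_self.trans h1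
      exact absurd h2 (not_le.2 (lt_add_one b))
  refine ⟨_, _, isClassKLL_of_expDecay hαK hκ hcpos, hψ, ?_⟩
  intro w _ hwfin dom ξ hsol hinit t j htj
  have ht0 : 0 ≤ t := hsol.timeDomain.1 _ htj
  set ω := (inputNorm w).toNNReal
  set q := (ξ 0 0).stackNorm
  rcases j with _ | j
  · have := hsol.eq_zero_of_admissibleInit hinit htj
    subst this
    have hE : expDecay c 0 = 1 := by simp [expDecay]
    simp only [Real.toNNReal_zero, Nat.cast_zero, add_zero, hE, mul_one]
    rw [add_assoc]
    exact le_self_add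
  · obtain ⟨Q, hQ, hVx, hη, hjt, y, hVy, he⟩ :=
      hbound (ae_nnnorm_le_inputNorm hwfin) hsol hinit htj
    set E := expDecay c (t.toNNReal + ((j + 1 : ℕ) : ℝ≥0))
    have hlev : level V (ξ 0 0) ≤ αVup q + q := by
      refine max_le ?_ ?_
      · refine (hVb _).2.trans ?_
        have h1 : αVup ‖(ξ 0 0).x‖₊ ≤ αVup q := hVup.strictMono.monotone (nnnorm_x_le_stackNorm _)
        exact (NNReal.coe_le_coe.2 h1).trans (le_add_of_nonneg_right q.2)
      · have h1 : ‖(ξ 0 0).η.ofLp‖ ≤ ‖(ξ 0 0).η‖ := by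
          refine (pi_norm_le_iff_of_nonneg (norm_nonneg _)).2 fun k => PiLp.norm_apply_le _ k
        have h2 : ‖(ξ 0 0).η‖ ≤ q := nnnorm_η_le_stackNorm (ξ 0 0)
        exact (h1.trans h2).trans (le_add_of_nonneg_left (αVup q).2)
    have hexp : Real.exp (-a * t) ≤ Real.exp (a * h / 2) * E := by
      rw [coe_expDecay, ← Real.exp_add]
      refine Real.exp_le_exp.2 ?_
      push_cast
      rw [Real.coe_toNNReal t ht0]
      have h1 : c * t ≤ a / 2 * t := mul_le_mul_of_nonneg_right (min_le_left _ _) ht0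
      have h2 : c * (j + 1) ≤ a * h / 2 * (j + 1) :=
        mul_le_mul_of_nonneg_right (min_le_right _ _) (by positivity)
      have h3 : a / 2 * (j * h) ≤ a / 2 * t := mul_le_mul_of_nonneg_left hjt (by positivity)
      linarith
    have hQle : Q ≤ ((K' * (αVup q + q) * E + D * αw ω : ℝ≥0) : ℝ) := by
      rw [hQ, hK']
      push_cast
      rw [Real.coe_toNNReal _ (Real.exp_pos _).le]
      refine add_le_add ?_ le_rfl
      have h0 := level_nonneg V (ξ 0 0)
      calc K * Real.exp (-a * t) * level V (ξ 0 0)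
          ≤ K * (Real.exp (a * h / 2) * E) * (αVup q + q) := by gcongr
        _ = _ := by ring
    set P : ℝ≥0 := K' * (αVup q + q) * E + D * αw ω
    have hσle : ∀ z, V z ≤ Q → ‖z‖₊ ≤ σ P := by
      intro z hz
      rw [← hσinv ‖z‖₊]
      exact hσ.strictMono.monotone (NNReal.coe_le_coe.1 ((hVb z).1.trans (hz.trans hQle)))
    have h1 := hσle _ hVx
    have h2 : ‖(ξ t (j + 1)).e‖₊ ≤ σ P + σ P := by
      rw [he]
      exact (nnnorm_sub_le _ _).trans (add_le_add (hσle _ hVy) h1)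
    have h3 : ‖(ξ t (j + 1)).η‖₊ ≤ c₀ * P := by
      refine (hc₀ _).trans (mul_le_mul_right ?_ _)
      exact NNReal.coe_le_coe.1 (hη.trans hQle)
    calc (ξ t (j + 1)).stackNorm ≤ σ P + (σ P + σ P) + c₀ * P :=
          (stackNorm_le_add _).trans (add_le_add (add_le_add h1 h2) h3)
      _ = 3 * σ P + c₀ * P := by ring
      _ ≤ α (K' * (αVup q + q) * E) + α (D * αw ω) := hαadd _ _
      _ ≤ (q * E + α (K' * (αVup q + q) * E)) + (α (D * αw ω) + ω) :=
          add_le_add le_add_self le_self_add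

end Stability

end STC

theorem theorem1 {nxp nxc nu nw : ℕ}
    (fp : EuclideanSpace ℝ (Fin nxp) → EuclideanSpace ℝ (Fin nu) → EuclideanSpace ℝ (Fin nw) →
      EuclideanSpace ℝ (Fin nxp))
    (fc : EuclideanSpace ℝ (Fin nxc) → EuclideanSpace ℝ (Fin nxp) → EuclideanSpace ℝ (Fin nxc))
    (gc : EuclideanSpace ℝ (Fin nxc) → EuclideanSpace ℝ (Fin nxp) → EuclideanSpace ℝ (Fin nu))
    (hf : Continuous fun p : Comb nxp nxc × Comb nxp nxc × EuclideanSpace ℝ (Fin nw) =>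
      closedLoop fp fc gc p.1 p.2.1 p.2.2)
    (N m : ℕ) (hm : 1 < m)
    (V : Comb nxp nxc → ℝ) (αw : ℝ≥0 → ℝ≥0) (ε γ L : Fin (N + 1) → ℝ)
    (hLyap : ∀ i, HybridLyapunovAssumption (closedLoop fp fc gc) V αw (ε i) (γ i) (L i))
    (hε : 0 < ε 0)
    (δ : ℝ) (hδ : δ ∈ Ioo (0 : ℝ) 1) (εref : ℝ) (hεref : 0 < εref) :
    0 < δ * Tmax (γ 0) (L 0 + ε 0 / 2) ∧
    (∀ (w : ℝ → EuclideanSpace ℝ (Fin nw)), LocallyIntegrableOn w (Ici 0) →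
      ∀ (dom : Set (ℝ × ℕ)) (ξ : ℝ → ℕ → State (Comb nxp nxc) (m - 1)),
        IsSolution (hybridSTC (closedLoop fp fc gc) (firS m V δ εref ε γ L)
          (firΓ m V δ εref ε γ L)) w dom ξ →
        AdmissibleInit (ξ 0 0) →
        ∀ (j : ℕ) (t t' : ℝ), IsSamplingInstant dom j t → IsSamplingInstant dom (j + 1) t' →
          δ * Tmax (γ 0) (L 0 + ε 0 / 2) ≤ t' - t) ∧
    IsISS (hybridSTC (closedLoop fp fc gc) (firS m V δ εref ε γ L) (firΓ m V δ εref ε γ L)) := by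
  refine ⟨fallback_pos hLyap hε hδ.1, ?_, isISS_hybridSTC hf hm hLyap hε hδ hεref⟩
  intro w _ dom ξ hsol _ j t t' ht ht'
  rw [hsol.sampling_eq ht ht']
  exact fallback_le_firΓ _ _
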